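/- Let $\mathcal A$ be a finite alphabet, let $T$ be the left shift on $\mathcal A^{\mathbb N}$, and let $\mathbb P,\mathbb Q$ be shift-invariant Borel probability measures on $\mathcal A^{\mathbb N}$ (product topology). For $a\in\mathcal A^n$ write $\mathbb P[a]$ for the probability of the cylinder $\{x : x_1^n=a\}$, let $\operatorname{supp}\mathbb P_n=\{a\in\mathcal A^n:\mathbb P[a]>0\}$ and $\operatorname{supp}\mathbb P=\{x:\mathbb P[x_1^n]>0\text{ for all }n\}$, and similarly for $\mathbb Q$. **Estimator.** For $x,y\in\mathcal A^{\mathbb N}$ let $W_\ell(y,x)=\inf\{r\ge 1: x_r^{r+\ell-1}=y_1^\ell\}$ and $\Lambda_N(y,x)=\max\{1,\sup\{\ell\ge 1: W_\ell(y,x)\le N-\ell+1\}\}$ (with $\inf\emptyset=\infty$ and $\sup\emptyset=0$). Put $L_0=0$ and, as long as $L_i<N$, $L_{i+1}=\min\{N,\,L_i+\Lambda_N(T^{L_i}y,x)+1\}$; the words $y_{L_i+1}^{L_{i+1}}$ form the modified Ziv–Merhav parsing of $y_1^N$ with respect to $x_1^N$. Let $c_N(y|x)$ be the number of these words and $$Q_N(y,x)=\frac{c_N(y|x)\,\ln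 N}{N-c_N(y|x)}.$$ **Conditions.** - A measure $\mathbb P$ satisfies (UD) if there are sequences $k_n\in[0,\infty)$ and $\tau_n\in\{0,1,2,\dots\}$, both $o(n)$, such that for all $n,m\ge 1$, $a\in\operatorname{supp}\mathbb P_n$, $\xi\in\operatorname{supp}\mathbb P_{\tau_n}$, $b\in\operatorname{supp}\mathbb P_m$ one has $\mathbb P[a\xi b]\le e^{k_n}\mathbb P[a]\mathbb P[b]$. - $\mathbb P$ satisfies (SLD) if there are such sequences for which, for all $n,m\ge1$, $a\in\operatorname{supp}\mathbb P_n$, $b\in\operatorname{supp}\mathbb P_m$, there exist $0\le\ell\le\tau_n$ and $\xi\in\operatorname{supp}\mathbb P_\ell$ with $\mathbb P[a\xi b]\ge e^{-k_n}\mathbb P[a]\mathbb P[b]$. - $\mathbb P$ satisfies (SE) if there are $\beta\ge1$ and $\gamma_-<0$ with $\min_{a\in\operatorname{supp}\mathbb P_n}\mathbb P[a]\ge e^{\gamma_- n^\beta}$ for all $n\ge1$. - $(\mathbb P,\mathbb Q)$ satisfies (ND) if $\bar q(-1)<0$, where $$\bar q(\alpha)=\limsup_{n\to\infty}\frac1n\ln\sum_{a\in\operatorname{supp}\mathbb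 P_n}\mathbb P[a]^{-\alpha}\,\mathbb Q[a].$$ **Statement.** Suppose that $\mathbb P$ satisfies (SLD), (UD) and (SE), that $\mathbb Q$ satisfies (UD), that $(\mathbb P,\mathbb Q)$ satisfies (ND), and that $\operatorname{supp}\mathbb Q\subseteq\operatorname{supp}\mathbb P$. Suppose in addition that there is an open interval containing $0$ on which the limit $$q(\alpha)=\lim_{n\to\infty}\frac1n\ln\sum_{a\in\operatorname{supp}\mathbb P_n}\mathbb P[a]^{-\alpha}\,\mathbb Q[a]$$ exists and is finite for every $\alpha$, and that $q$ is differentiable at $0$. Then the cross entropy $$h_{\mathrm c}(\mathbb Q|\mathbb P)=\lim_{n\to\infty}-\frac1n\sum_{a\in\mathcal A^n}\mathbb Q[a]\ln\mathbb P[a]$$ exists and is finite, and $$\lim_{N\to\infty}Q_N(y,x)=h_{\mathrm c}(\mathbb Q|\mathbb P)\qquad\text{for }(\mathbb P\otimes\mathbb Q)\text{-almost every }(x,y).$$ -/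

import Mathlib

open MeasureTheory Filter Topology Asymptotics

noncomputable section

namespace ZivMerhav

variable {A : Type*}

/-- The left shift `T` on one-sided sequences. The letter written `x_k` (with `k ≥ 1`) in
one-based notation is `x (k - 1)` here. -/
def shift (x : ℕ → A) : ℕ → A := fun n => x (n + 1)

/-- The block of length `l` of `x` that follows its first `k` letters, i.e. `x_{k+1}^{k+l}` in
one-based notation. -/
def block (x : ℕ → A) (k l : ℕ) : Fin l → A := fun i => x (k + i)

/-- The waiting time `W_l(y, x)`: the least one-based position `r = k + 1` at which `y_1^l`
occurs in `x`; it is `⊤` if there is no occurrence. -/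
def waitingTime (l : ℕ) (y x : ℕ → A) : ℕ∞ :=
  ⨅ (k : ℕ) (_ : block x k l = block y 0 l), ((k + 1 : ℕ) : ℕ∞)

/-- The lengths `l ≥ 1` with `W_l(y, x) ≤ N - l + 1`. -/
def matchLengths (N : ℕ) (y x : ℕ → A) : Set ℕ :=
  {l : ℕ | 1 ≤ l ∧ waitingTime l y x + (l : ℕ∞) ≤ (N : ℕ∞) + 1}

/-- The match length `Λ_N(y, x)`. The set is bounded by `N` (see `le_of_mem_matchLengths`),
and the supremum of the empty set is `0`. -/
def matchLength (N : ℕ) (y x : ℕ → A) : ℕ := max 1 (sSup (matchLengths N y x))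

theorem le_of_mem_matchLengths {N : ℕ} {y x : ℕ → A} {l : ℕ} (h : l ∈ matchLengths N y x) :
    l ≤ N := by
  have h1 : (1 : ℕ∞) ≤ waitingTime l y x := by
    refine le_iInf₂ fun k _ => ?_
    exact_mod_cast Nat.le_add_left 1 k
  have h2 : (1 : ℕ∞) + l ≤ (N : ℕ∞) + 1 := le_trans (by gcongr) h.2
  have h3 : 1 + l ≤ N + 1 := by exact_mod_cast h2
  omega

/-- The total length `L_{i,N}` of the first `i` words in the modified Ziv--Merhav parsing of
`y_1^N` with respect to `x_1^N`. The word number `i + 1` consists of the letters of `y` at the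
one-based positions `L_i + 1, …, L_{i+1}`; the parsing ends when `L_i = N`. -/
def parsedLength (N : ℕ) (y x : ℕ → A) : ℕ → ℕ
  | 0 => 0
  | i + 1 => min N (parsedLength N y x i +
      matchLength N (shift^[parsedLength N y x i] y) x + 1)

/-- The number `c_N(y|x)` of words in the modified Ziv--Merhav parsing: the first `i` with
`L_{i,N} = N` (it exists, see `exists_parsedLength_eq`). -/
def wordCount (N : ℕ) (y x : ℕ → A) : ℕ := sInf {i : ℕ | parsedLength N y x i = N}

theorem exists_parsedLength_eq (N : ℕ) (y x : ℕ → A) : ∃ i, parsedLength N y x i = N := by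
  have h : ∀ i, min N i ≤ parsedLength N y x i ∧ parsedLength N y x i ≤ N := by
    intro i
    induction i with
    | zero => simp [parsedLength]
    | succ i ih => simp only [parsedLength]; omega
  exact ⟨N, by have := h N; omega⟩

/-- The modified Ziv--Merhav estimator `Q_N(y, x) = c_N ln N / (N - c_N)`. -/
def mZMEstimator (N : ℕ) (y x : ℕ → A) : ℝ :=
  ((wordCount N y x : ℝ) * Real.log N) / ((N : ℝ) - (wordCount N y x : ℝ))

/-- The basic cylinder set `[a]` of sequences that start with the word `a`. -/
def cylinder {n : ℕ} (a : Fin n → A) : Set (ℕ → A) := {x | block x 0 n = a}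

/-- The concatenation `aξb` of three words. -/
def concat3 {n l m : ℕ} (a : Fin n → A) (ξ : Fin l → A) (b : Fin m → A) : Fin (n + l + m) → A :=
  Fin.append (Fin.append a ξ) b

variable [MeasurableSpace A]

/-- The probability `P[a]` of a basic cylinder. -/
def cylProb (P : Measure (ℕ → A)) {n : ℕ} (a : Fin n → A) : ℝ := P.real (cylinder a)

/-- The support of the `n`-th marginal: the words of length `n` of positive probability. -/
def wordSupp (P : Measure (ℕ → A)) (n : ℕ) : Set (Fin n → A) := {a | 0 < cylProb P a}

/-- The support of `P`: the sequences all of whose prefixes have positive probability. -/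
def seqSupp (P : Measure (ℕ → A)) : Set (ℕ → A) := {x | ∀ n, block x 0 n ∈ wordSupp P n}

/-- Upper decoupling. -/
def UpperDecoupled (P : Measure (ℕ → A)) : Prop :=
  ∃ (k : ℕ → ℝ) (τ : ℕ → ℕ),
    (∀ n, 0 ≤ k n) ∧ k =o[atTop] (fun n : ℕ => (n : ℝ)) ∧
    (fun n => (τ n : ℝ)) =o[atTop] (fun n : ℕ => (n : ℝ)) ∧
    ∀ n, 1 ≤ n → ∀ a ∈ wordSupp P n, ∀ ξ ∈ wordSupp P (τ n),
      ∀ m, 1 ≤ m → ∀ b ∈ wordSupp P m,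
        cylProb P (concat3 a ξ b) ≤ Real.exp (k n) * (cylProb P a * cylProb P b)

/-- Selective lower decoupling. -/
def SelectivelyLowerDecoupled (P : Measure (ℕ → A)) : Prop :=
  ∃ (k : ℕ → ℝ) (τ : ℕ → ℕ),
    (∀ n, 0 ≤ k n) ∧ k =o[atTop] (fun n : ℕ => (n : ℝ)) ∧
    (fun n => (τ n : ℝ)) =o[atTop] (fun n : ℕ => (n : ℝ)) ∧
    ∀ n, 1 ≤ n → ∀ a ∈ wordSupp P n, ∀ m, 1 ≤ m → ∀ b ∈ wordSupp P m,
      ∃ l, l ≤ τ n ∧ ∃ ξ ∈ wordSupp P l,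
        Real.exp (-k n) * (cylProb P a * cylProb P b) ≤ cylProb P (concat3 a ξ b)

/-- Slow enough decay of the probabilities of cylinders. -/
def DecaysSlowlyEnough (P : Measure (ℕ → A)) : Prop :=
  ∃ β γ : ℝ, 1 ≤ β ∧ γ < 0 ∧
    ∀ n, 1 ≤ n → ∀ a ∈ wordSupp P n, Real.exp (γ * (n : ℝ) ^ β) ≤ cylProb P a

variable [Fintype A]

open Classical in
/-- The quantity `(1/n) ln ∑_{a ∈ supp P_n} P[a]^{-α} Q[a]`, with `ln 0 = -∞`. -/
def pressureSeq (P Q : Measure (ℕ → A)) (α : ℝ) (n : ℕ) : EReal :=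
  ENNReal.log (ENNReal.ofReal
    (∑ a : Fin n → A with a ∈ wordSupp P n, cylProb P a ^ (-α) * cylProb Q a)) / (n : EReal)

/-- The cross-entropic pressure `α ↦ limsup_n (1/n) ln ∑_{a ∈ supp P_n} P[a]^{-α} Q[a]`. -/
def upperPressure (P Q : Measure (ℕ → A)) (α : ℝ) : EReal :=
  limsup (fun n => pressureSeq P Q α n) atTop

/-- Nondegeneracy of the pair `(P, Q)`. -/
def Nondegenerate (P Q : Measure (ℕ → A)) : Prop := upperPressure P Q (-1) < 0

/-- The quantity `-(1/n) ∑_{a ∈ Aⁿ} Q[a] ln P[a]`, with `ln 0 = -∞` and `0 · (-∞) = 0`. -/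
def crossEntropySeq (P Q : Measure (ℕ → A)) (n : ℕ) : EReal :=
  (-∑ a : Fin n → A, (cylProb Q a : EReal) * ENNReal.log (P (cylinder a))) / (n : EReal)

/-- `h` is the (specific) cross entropy `h_c(Q|P)`: the defining limit exists and equals `h`. -/
def IsCrossEntropy (P Q : Measure (ℕ → A)) (h : EReal) : Prop :=
  Tendsto (crossEntropySeq P Q) atTop (𝓝 h)

end ZivMerhav

end

open ZivMerhav

/-! Let `h = q'(0)`. Since `q 0 = 0`, the pressure at small exponents of either sign gives Chernoff
bounds: outside an exponentially small `Q`-probability, a block of length `l` has `P`-probability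
between `exp (-(h + ε) l)` and `exp (-(h - ε) l)`. Such a block should occur in `x_1^N` when `l` is
below `ln N / h` and not when `l` is above it, so parsed words have length about `ln N / h` and
`c_N` is about `h N / ln N`.

Absence of long blocks is a union bound over positions (`prod_real_occurs_le`). Presence of short
blocks uses selective lower decoupling, which makes the probability of non-occurrence decay
geometrically as the window grows (`measureReal_not_occurs_le`).

The parsing positions are random and depend on `x`, but this is harmless: `wordCount_mul_le` and
`le_wordCount_mul` are deterministic and involve only the number of bad positions among all
positions of `y_1^N`. By stationarity that number has small mean; Markov's inequality and
Borel–Cantelli along dyadic scales (`ae_eventually_card_le`) make it negligible almost surely. In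
the lower bound, a word starting at a bad position might be very long; nondegeneracy limits it to
`O(ln N)` letters.

The bounds in `MomentBounds` also give the cross entropy: Jensen's inequality turns them into bounds
on the mean of `-ln P[a]`. The same argument with nondegeneracy gives `h > 0`. -/

namespace ZivMerhav

/-! ### Deterministic bounds on the number of parsed words. -/

section Parsing

variable {A : Type*}

theorem shift_iterate_apply (k : ℕ) (x : ℕ → A) (n : ℕ) : shift^[k] x n = x (k + n) := by
  induction k generalizing x n with
  | zero => simp
  | succ k ih =>
    rw [Function.iterate_succ_apply, ih]
    simp only [shift]
    congr 1
    omega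

theorem block_shift_iterate (k i l : ℕ) (x : ℕ → A) :
    block (shift^[k] x) i l = block x (k + i) l := by
  funext j
  simp [block, shift_iterate_apply, add_assoc]

/-- The word `a` occurs in the first `N` letters of `x`. -/
def Occurs (N : ℕ) (x : ℕ → A) {l : ℕ} (a : Fin l → A) : Prop :=
  ∃ k, k + l ≤ N ∧ block x k l = a

theorem Occurs.mono {M N : ℕ} (h : M ≤ N) {x : ℕ → A} {l : ℕ} {a : Fin l → A}
    (ha : Occurs M x a) : Occurs N x a := by
  obtain ⟨k, hk, rfl⟩ := ha
  exact ⟨k, hk.trans h, rfl⟩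

theorem Occurs.block_of_le {N : ℕ} {x y : ℕ → A} {i l m : ℕ} (h : l ≤ m)
    (hm : Occurs N x (block y i m)) : Occurs N x (block y i l) := by
  obtain ⟨k, hk, hb⟩ := hm
  refine ⟨k, by omega, funext fun j => ?_⟩
  exact congrFun hb ⟨j, j.2.trans_le h⟩

theorem mem_matchLengths_iff {N l : ℕ} {y x : ℕ → A} :
    l ∈ matchLengths N y x ↔ 1 ≤ l ∧ Occurs N x (block y 0 l) := by
  simp only [matchLengths, Set.mem_ofPred_eq]
  refine and_congr_right fun _ => ⟨fun h => ?_, ?_⟩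
  · by_contra hno
    have h1 : ((N + 2 - l : ℕ) : ℕ∞) ≤ waitingTime l y x := by
      refine le_iInf₂ fun k hk => ?_
      have : ¬ k + l ≤ N := fun hkl => hno ⟨k, hkl, hk⟩
      exact_mod_cast (by omega : N + 2 - l ≤ k + 1)
    have h2 : ((N + 2 - l : ℕ) : ℕ∞) + l ≤ (N : ℕ∞) + 1 := le_trans (by gcongr) h
    have h3 : (N + 2 - l) + l ≤ N + 1 := by exact_mod_cast h2
    omega
  · rintro ⟨k, hk, hb⟩
    have h1 : waitingTime l y x ≤ ((k + 1 : ℕ) : ℕ∞) := iInf₂_le k hb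
    calc waitingTime l y x + (l : ℕ∞) ≤ ((k + 1 : ℕ) : ℕ∞) + l := by gcongr
      _ ≤ (N : ℕ∞) + 1 := by exact_mod_cast (by omega : k + 1 + l ≤ N + 1)

theorem bddAbove_matchLengths (N : ℕ) (y x : ℕ → A) : BddAbove (matchLengths N y x) :=
  ⟨N, fun _ h => le_of_mem_matchLengths h⟩

theorem le_matchLength_of_occurs {N l k : ℕ} {y x : ℕ → A} (h : Occurs N x (block y k l)) :
    l ≤ matchLength N (shift^[k] y) x := by
  rcases Nat.eq_zero_or_pos l with rfl | hl
  · exact Nat.zero_le _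
  refine le_trans (le_csSup (bddAbove_matchLengths _ _ _) ?_) (le_max_right _ _)
  rw [mem_matchLengths_iff, block_shift_iterate]
  exact ⟨hl, h⟩

/-- Length 1 must be excluded: the match length is 1 by default even when the letter does not occur.
-/
theorem occurs_of_le_matchLength {N l k : ℕ} {y x : ℕ → A} (hl : 2 ≤ l)
    (h : l ≤ matchLength N (shift^[k] y) x) : Occurs N x (block y k l) := by
  set S := matchLengths N (shift^[k] y) x with hS
  have h1 : l ≤ sSup S := by
    rcases le_max_iff.mp (show l ≤ max 1 (sSup S) from h) with h | h
    · omega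
    · exact h
  have hne : S.Nonempty := by
    by_contra hne
    rw [Set.not_nonempty_iff_eq_empty] at hne
    rw [hne, csSup_empty, bot_eq_zero] at h1
    omega
  have h2 := Nat.sSup_mem hne (bddAbove_matchLengths _ _ _)
  rw [hS, mem_matchLengths_iff, block_shift_iterate] at h2
  exact h2.2.block_of_le h1

theorem parsedLength_le (N : ℕ) (y x : ℕ → A) (i : ℕ) : parsedLength N y x i ≤ N := by
  cases i <;> simp [parsedLength]

theorem parsedLength_wordCount (N : ℕ) (y x : ℕ → A) :
    parsedLength N y x (wordCount N y x) = N :=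
  Nat.sInf_mem (s := {i : ℕ | parsedLength N y x i = N}) (exists_parsedLength_eq N y x)

theorem parsedLength_lt {N : ℕ} {y x : ℕ → A} {i : ℕ} (hi : i < wordCount N y x) :
    parsedLength N y x i < N :=
  lt_of_le_of_ne (parsedLength_le N y x i) fun h => Nat.notMem_of_lt_sInf hi h

open Classical in
/-- If all but `b` of the blocks of length `r` of `y_1^N` occur in `x_1^N`, then at most `1 + b + N / (r + 1)` words are parsed. -/
theorem wordCount_mul_le {N r : ℕ} {y x : ℕ → A} :
    wordCount N y x * (r + 1) ≤ N + (r + 1) + (r + 1) *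
      ((Finset.range N).filter fun k => ¬ Occurs N x (block y k r)).card := by
  set bad : ℕ → Finset ℕ := fun n => (Finset.range n).filter fun k => ¬ Occurs N x (block y k r)
  -- A word starting at a good position has at least `r + 1` letters. One starting at a bad position
  -- adds that position to the count, and starting positions are distinct.
  have key : ∀ i, parsedLength N y x i < N →
      i * (r + 1) ≤ parsedLength N y x i + (r + 1) * (bad (parsedLength N y x i)).card := by
    intro i
    induction i with
    | zero => simp
    | succ i ih =>
      intro hlt
      set L := parsedLength N y x i with hL
      have hLN : L < N := by
        refine lt_of_le_of_ne (parsedLength_le N y x i) fun h => ?_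
        rw [parsedLength, ← hL, h] at hlt
        omega
      have ih' := ih hLN
      have hstep : parsedLength N y x (i + 1) = L + matchLength N (shift^[L] y) x + 1 := by
        rw [parsedLength, ← hL] at hlt ⊢
        omega
      set L' := parsedLength N y x (i + 1)
      have hsub : bad L ⊆ bad L' :=
        Finset.filter_subset_filter _ (Finset.range_subset_range.mpr (by omega))
      by_cases ho : Occurs N x (block y L r)
      · have h1 := le_matchLength_of_occurs ho
        have h2 := Finset.card_le_card hsub
        have h3 := Nat.mul_le_mul_left (r + 1) h2
        rw [add_mul]
        omega
      · have h2 : (bad L).card + 1 ≤ (bad L').card := by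
          rw [← Finset.card_insert_of_notMem (s := bad L) (a := L) (by simp [bad])]
          refine Finset.card_le_card (Finset.insert_subset ?_ hsub)
          simp only [bad, Finset.mem_filter, Finset.mem_range]
          exact ⟨by omega, ho⟩
        have h3 := Nat.mul_le_mul_left (r + 1) h2
        rw [mul_add] at h3
        rw [add_mul]
        omega
  -- The last word may be truncated at `N`, so the invariant is applied just before it; this costs
  -- the extra `r + 1`.
  rcases Nat.eq_zero_or_pos (wordCount N y x) with h0 | hpos
  · rw [h0]; simp
  · have hlt := parsedLength_lt (Nat.sub_lt hpos one_pos)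
    have h1 := key _ hlt
    have h2 : (bad (parsedLength N y x (wordCount N y x - 1))).card ≤ (bad N).card :=
      Finset.card_le_card
        (Finset.filter_subset_filter _ (Finset.range_subset_range.mpr hlt.le))
    have h3 := Nat.mul_le_mul_left (r + 1) h2
    obtain ⟨c, hc⟩ : ∃ c, wordCount N y x = c + 1 := ⟨_, (Nat.succ_pred_eq_of_pos hpos).symm⟩
    rw [hc] at h1 h3 hlt ⊢
    rw [add_mul]
    simp only [Nat.add_sub_cancel] at h1 h3 hlt
    change _ ≤ _ + (r + 1) * (bad N).card
    omega

open Classical in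
/-- If no block of length `K` of `y_1^N` occurs in `x` and all but `b` of those of length `R` do
not occur, then at least `(N - b K) / R` words are parsed. -/
theorem le_wordCount_mul {N R K : ℕ} {y x : ℕ → A} (hR : 2 ≤ R) (hK : 2 ≤ K)
    (hlong : ∀ k < N, ¬ Occurs N x (block y k K)) :
    N ≤ wordCount N y x * R +
      K * ((Finset.range N).filter fun k => Occurs N x (block y k R)).card := by
  set bad : ℕ → Finset ℕ := fun n => (Finset.range n).filter fun k => Occurs N x (block y k R)
  have key : ∀ i, i ≤ wordCount N y x →
      parsedLength N y x i ≤ i * R + K * (bad (parsedLength N y x i)).card := by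
    intro i
    induction i with
    | zero => simp [parsedLength]
    | succ i ih =>
      intro hle
      have ih' := ih (by omega)
      have hLN := parsedLength_lt (show i < wordCount N y x by omega)
      set L := parsedLength N y x i with hL
      have hstep : parsedLength N y x (i + 1) ≤ L + matchLength N (shift^[L] y) x + 1 :=
        min_le_right _ _
      have hgt : L < parsedLength N y x (i + 1) := by
        rw [parsedLength, ← hL]
        omega
      set L' := parsedLength N y x (i + 1)
      have hsub : bad L ⊆ bad L' :=
        Finset.filter_subset_filter _ (Finset.range_subset_range.mpr (by omega))
      rw [add_mul]
      by_cases ho : Occurs N x (block y L R)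
      · have h2 : (bad L).card + 1 ≤ (bad L').card := by
          rw [← Finset.card_insert_of_notMem (s := bad L) (a := L) (by simp [bad])]
          refine Finset.card_le_card (Finset.insert_subset ?_ hsub)
          simp only [bad, Finset.mem_filter, Finset.mem_range]
          exact ⟨by omega, ho⟩
        have h3 := Nat.mul_le_mul_left K h2
        rw [mul_add] at h3
        -- A word has at most one letter more than its match, hence at most `K` letters here and at
        -- most `R` in the other case.
        have h1 : ¬ K ≤ matchLength N (shift^[L] y) x := fun h =>
          hlong L hLN (occurs_of_le_matchLength hK h)
        omega
      · have h1 : ¬ R ≤ matchLength N (shift^[L] y) x := fun h =>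
          ho (occurs_of_le_matchLength hR h)
        have h3 := Nat.mul_le_mul_left K (Finset.card_le_card hsub)
        omega
  have := key _ le_rfl
  rwa [parsedLength_wordCount] at this

theorem block_mem_cylinder_concat {n l m : ℕ} {x : ℕ → A} {a : Fin n → A} {ξ : Fin l → A}
    {b : Fin m → A} (h : x ∈ cylinder (concat3 a ξ b)) :
    block x 0 n = a ∧ block x (n + l) m = b := by
  have h' : block x 0 (n + l + m) = concat3 a ξ b := h
  constructor
  · funext i
    have := congrFun h' (Fin.castAdd m (Fin.castAdd l i))
    simpa [concat3, block] using this
  · funext i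
    have := congrFun h' (Fin.natAdd (n + l) i)
    simpa [concat3, block] using this

end Parsing

/-! ### Probabilities of occurrence of a fixed word. -/

section Measure

variable {A : Type*} [MeasurableSpace A]

theorem measurable_block (k l : ℕ) : Measurable fun x : ℕ → A => block x k l :=
  measurable_pi_lambda _ fun _ => measurable_pi_apply _

theorem measurable_shift : Measurable (shift : (ℕ → A) → ℕ → A) :=
  measurable_pi_lambda _ fun _ => measurable_pi_apply _

theorem cylProb_nonneg (P : Measure (ℕ → A)) {n : ℕ} (a : Fin n → A) : 0 ≤ cylProb P a :=
  measureReal_nonneg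

theorem cylProb_le_one (P : Measure (ℕ → A)) [IsProbabilityMeasure P] {n : ℕ} (a : Fin n → A) :
    cylProb P a ≤ 1 :=
  measureReal_le_one

theorem measureReal_preimage_shift {P : Measure (ℕ → A)} (hP : MeasurePreserving shift P P)
    (k : ℕ) {S : Set (ℕ → A)} (hS : MeasurableSet S) : P.real (shift^[k] ⁻¹' S) = P.real S := by
  simp only [measureReal_def, (hP.iterate k).measure_preimage hS.nullMeasurableSet]

variable [Fintype A]

theorem ae_mem_seqSupp (Q : Measure (ℕ → A)) [IsProbabilityMeasure Q] :
    ∀ᵐ y ∂Q, y ∈ seqSupp Q := by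
  refine ae_all_iff.mpr fun n => ?_
  have : {y : ℕ → A | ¬ block y 0 n ∈ wordSupp Q n} =
      ⋃ a ∈ {a : Fin n → A | a ∉ wordSupp Q n}, cylinder a := by
    ext x; simp [cylinder]
  rw [ae_iff, this, measure_biUnion_null_iff (Set.to_countable _)]
  intro a ha
  have h0 : ¬ 0 < cylProb Q a := ha
  have h1 : Q.real (cylinder a) = 0 := le_antisymm (not_lt.mp h0) measureReal_nonneg
  exact (measureReal_eq_zero_iff).mp h1

/-- `seqSupp Q` has full `Q`-measure, so a cylinder of positive `Q`-measure contains one of its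
points. -/
theorem wordSupp_subset {P Q : Measure (ℕ → A)} [IsProbabilityMeasure Q]
    (h : seqSupp Q ⊆ seqSupp P) {n : ℕ} : wordSupp Q n ⊆ wordSupp P n := by
  intro a ha
  have ha' : 0 < Q.real (cylinder a) := ha
  have hpos : Q (cylinder a) ≠ 0 := fun h0 => by simp [measureReal_def, h0] at ha'
  obtain ⟨y, hy, hs⟩ :=
    (frequently_ae_mem_iff.mpr hpos |>.and_eventually (ae_mem_seqSupp Q)).exists
  have := h hs n
  rwa [show block y 0 n = a from hy] at this

variable [MeasurableSingletonClass A]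

theorem measurableSet_block_mem (k l : ℕ) (S : Set (Fin l → A)) :
    MeasurableSet {x : ℕ → A | block x k l ∈ S} :=
  measurable_block k l S.toFinite.measurableSet

theorem measurableSet_cylinder {n : ℕ} (a : Fin n → A) : MeasurableSet (cylinder a) :=
  measurableSet_block_mem 0 n {a}

theorem measurableSet_occurs (N : ℕ) {l : ℕ} (a : Fin l → A) :
    MeasurableSet {x : ℕ → A | Occurs N x a} := by
  have : {x : ℕ → A | Occurs N x a} =
      ⋃ k ∈ {k : ℕ | k + l ≤ N}, {x : ℕ → A | block x k l ∈ ({a} : Set (Fin l → A))} := by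
    ext x; simp [Occurs]
  rw [this]
  exact MeasurableSet.biUnion (Set.to_countable _) fun k _ => measurableSet_block_mem k l {a}

theorem measureReal_block_eq {P : Measure (ℕ → A)} (hP : MeasurePreserving shift P P)
    (k : ℕ) {l : ℕ} (a : Fin l → A) : P.real {x | block x k l = a} = cylProb P a := by
  rw [cylProb, ← measureReal_preimage_shift hP k (measurableSet_cylinder a)]
  congr 1
  ext x
  simp [cylinder, block_shift_iterate]

/-- The measure of an event on `x` and a block of `y`, for independent `x` and `y`. -/
theorem prod_real_block_mem {P Q : Measure (ℕ → A)} [IsProbabilityMeasure P]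
    [IsProbabilityMeasure Q] (hQ : MeasurePreserving shift Q Q) (k : ℕ) {l : ℕ}
    (S : (Fin l → A) → Set (ℕ → A)) (hS : ∀ a, MeasurableSet (S a)) :
    (P.prod Q).real {p | p.1 ∈ S (block p.2 k l)} = ∑ a, P.real (S a) * cylProb Q a := by
  have hset : {p : (ℕ → A) × (ℕ → A) | p.1 ∈ S (block p.2 k l)} =
      ⋃ a ∈ (Finset.univ : Finset (Fin l → A)), S a ×ˢ {y | block y k l = a} := by
    ext p; simp
  have hmeas : ∀ a : Fin l → A, MeasurableSet (S a ×ˢ {y : ℕ → A | block y k l = a}) := fun a =>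
    (hS a).prod (measurableSet_block_mem k l {a})
  rw [hset, measureReal_biUnion_finset _ fun a _ => hmeas a]
  · refine Finset.sum_congr rfl fun a _ => ?_
    rw [measureReal_prod_prod, measureReal_block_eq hQ]
  · intro a _ b _ hab
    refine Set.disjoint_left.mpr fun p hp hq => hab ?_
    exact (hp.2 : block p.2 k l = a).symm.trans hq.2

theorem sum_cylProb (Q : Measure (ℕ → A)) [IsProbabilityMeasure Q] (n : ℕ) :
    ∑ a : Fin n → A, cylProb Q a = 1 := by
  rw [← probReal_univ (μ := Q)]
  have : (Set.univ : Set (ℕ → A)) = ⋃ a ∈ (Finset.univ : Finset (Fin n → A)), cylinder a := by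
    ext x; simp [cylinder]
  rw [this, measureReal_biUnion_finset _ fun a _ => measurableSet_cylinder a]
  · rfl
  · intro a _ b _ hab
    refine Set.disjoint_left.mpr fun p hp hq => hab ?_
    exact (hp : block p 0 n = a).symm.trans hq

theorem measureReal_occurs_le {P : Measure (ℕ → A)} [IsProbabilityMeasure P]
    (hP : MeasurePreserving shift P P) (N : ℕ) {l : ℕ} (hl : 1 ≤ l) (a : Fin l → A) :
    P.real {x | Occurs N x a} ≤ N * cylProb P a := by
  have hsub : {x : ℕ → A | Occurs N x a} ⊆ ⋃ k ∈ Finset.range N, {x | block x k l = a} := by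
    rintro x ⟨k, hk, hb⟩
    simp only [Set.mem_iUnion, Finset.mem_range]
    exact ⟨k, by omega, hb⟩
  calc P.real {x | Occurs N x a} ≤ P.real (⋃ k ∈ Finset.range N, {x | block x k l = a}) :=
        measureReal_mono hsub (measure_ne_top _ _)
    _ ≤ ∑ k ∈ Finset.range N, P.real {x | block x k l = a} := measureReal_biUnion_finset_le _ _
    _ = N * cylProb P a := by simp [measureReal_block_eq hP]

/-- One step of the decay of the probability that a word does not occur. -/
theorem measureReal_not_occurs_add_le {P : Measure (ℕ → A)} [IsProbabilityMeasure P]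
    (hP : MeasurePreserving shift P P) {l t m : ℕ} {c : ℝ} {a : Fin l → A}
    (hsld : ∀ b ∈ wordSupp P m, ∃ i, i ≤ t ∧ ∃ ξ ∈ wordSupp P i,
        c * (cylProb P a * cylProb P b) ≤ cylProb P (concat3 a ξ b)) :
    P.real {x | ¬ Occurs (m + (l + t)) x a} ≤
      (1 - c * cylProb P a) * P.real {x | ¬ Occurs m x a} := by
  classical
  have : Nonempty A := (nonempty_of_isProbabilityMeasure P).map fun x => x 0
  choose! i hit ξ hξ hge using hsld
  set D := l + t with hD
  set V := shift^[D] ⁻¹' {x : ℕ → A | ¬ Occurs m x a} with hV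
  have hmeas : ∀ n, MeasurableSet {x : ℕ → A | ¬ Occurs n x a} := fun n =>
    (measurableSet_occurs n a).compl
  -- Non-occurrence in the first `m` letters depends on those letters only; up to a null set it is
  -- the union of the cylinders over `T`.
  set T : Finset (Fin m → A) :=
    Finset.univ.filter fun b => b ∈ wordSupp P m ∧ cylinder b ⊆ {x | ¬ Occurs m x a} with hT
  -- The shift puts `b` at position `D` whatever the length of the gap `ξ b`, so the events for
  -- different `b` are disjoint.
  set E : (Fin m → A) → Set (ℕ → A) := fun b =>
    shift^[D - (l + i b)] ⁻¹' cylinder (concat3 a (ξ b) b) with hE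
  have hEmeas : ∀ b, MeasurableSet (E b) := fun b =>
    measurable_shift.iterate _ (measurableSet_cylinder _)
  have hEb : ∀ b ∈ T, ∀ x ∈ E b, block x (D - (l + i b)) l = a ∧ block x D m = b := by
    intro b hb x hx
    have hb' := (Finset.mem_filter.mp hb).2.1
    have h1 := block_mem_cylinder_concat (show shift^[_] x ∈ _ from hx)
    rw [block_shift_iterate, block_shift_iterate] at h1
    have h2 := hit b hb'
    rwa [show D - (l + i b) + (l + i b) = D by omega] at h1
  have hlocal : ∀ x y : ℕ → A, block x 0 m = block y 0 m → Occurs m x a → Occurs m y a := by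
    rintro x y hxy ⟨k, hk, hb⟩
    refine ⟨k, hk, ?_⟩
    rw [← hb]
    funext j
    have := congrFun hxy ⟨k + j, by omega⟩
    simpa [block] using this.symm
  have hVm : P.real {x | ¬ Occurs m x a} ≤ ∑ b ∈ T, cylProb P b := by
    have hsub : {x : ℕ → A | ¬ Occurs m x a} ⊆
        {x | x ∉ seqSupp P} ∪ ⋃ b ∈ T, cylinder b := by
      intro x hx
      by_cases hs : x ∈ seqSupp P
      · right
        simp only [Set.mem_iUnion]
        refine ⟨block x 0 m, ?_, rfl⟩
        simp only [hT, Finset.mem_filter, Finset.mem_univ, true_and]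
        exact ⟨hs m, fun y hy ho => hx (hlocal y x hy ho)⟩
      · exact Or.inl hs
    have h0 : P.real {x | x ∉ seqSupp P} = 0 := by
      rw [measureReal_eq_zero_iff]
      exact ae_mem_seqSupp P
    calc _ ≤ P.real ({x | x ∉ seqSupp P} ∪ ⋃ b ∈ T, cylinder b) := measureReal_mono hsub
      _ ≤ P.real {x | x ∉ seqSupp P} + P.real (⋃ b ∈ T, cylinder b) := measureReal_union_le _ _
      _ ≤ ∑ b ∈ T, cylProb P b := by
        rw [h0, zero_add]
        exact measureReal_biUnion_finset_le _ _
  have hunion : P.real (⋃ b ∈ T, E b) = ∑ b ∈ T, P.real (E b) := by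
    refine measureReal_biUnion_finset ?_ fun b _ => hEmeas b
    intro b hb b' hb' hne
    refine Set.disjoint_left.mpr fun x hx hx' => hne ?_
    rw [← (hEb b hb x hx).2, ← (hEb b' hb' x hx').2]
  have hdisj : Disjoint {x : ℕ → A | ¬ Occurs (m + D) x a} (⋃ b ∈ T, E b) := by
    refine Set.disjoint_left.mpr fun x hx hx' => hx ?_
    simp only [Set.mem_iUnion] at hx'
    obtain ⟨b, hb, hxb⟩ := hx'
    exact ⟨_, by omega, (hEb b hb x hxb).1⟩
  -- By stationarity `V` has the measure of non-occurrence in `m` letters. The events `E b` contain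
  -- an occurrence of `a`, so their mass is lost in passing to the longer window.
  have hsubV : {x : ℕ → A | ¬ Occurs (m + D) x a} ∪ (⋃ b ∈ T, E b) ⊆ V := by
    rintro x (hx | hx)
    · rintro ⟨k, hk, hb⟩
      rw [block_shift_iterate] at hb
      exact hx ⟨_, by omega, hb⟩
    · simp only [Set.mem_iUnion] at hx
      obtain ⟨b, hb, hxb⟩ := hx
      refine (Finset.mem_filter.mp hb).2.2 ?_
      change block _ 0 m = b
      rw [block_shift_iterate]
      exact (hEb b hb x hxb).2
  have h1 : P.real {x | ¬ Occurs (m + D) x a} + ∑ b ∈ T, P.real (E b) ≤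
      P.real {x | ¬ Occurs m x a} := by
    rw [← hunion, ← measureReal_union hdisj
      (Finset.measurableSet_biUnion _ fun b _ => hEmeas b) (measure_ne_top _ _) (measure_ne_top _ _),
      ← measureReal_preimage_shift hP D (hmeas m)]
    exact measureReal_mono hsubV (measure_ne_top _ _)
  have h2 : ∑ b ∈ T, c * (cylProb P a * cylProb P b) ≤ ∑ b ∈ T, P.real (E b) := by
    refine Finset.sum_le_sum fun b hb => ?_
    rw [hE, measureReal_preimage_shift hP _ (measurableSet_cylinder _)]
    exact hge b (Finset.mem_filter.mp hb).2.1
  by_cases hc : 0 ≤ c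
  · have h3 : c * cylProb P a * P.real {x | ¬ Occurs m x a} ≤
        ∑ b ∈ T, c * (cylProb P a * cylProb P b) := by
      calc _ ≤ c * cylProb P a * ∑ b ∈ T, cylProb P b :=
            mul_le_mul_of_nonneg_left hVm (mul_nonneg hc (cylProb_nonneg P a))
        _ = _ := by rw [Finset.mul_sum]; exact Finset.sum_congr rfl fun _ _ => by ring
    linarith
  · have h3 : 0 ≤ ∑ b ∈ T, P.real (E b) := Finset.sum_nonneg fun _ _ => measureReal_nonneg
    have h4 : 0 ≤ P.real {x | ¬ Occurs m x a} := measureReal_nonneg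
    have h5 : 0 ≤ -c * cylProb P a * P.real {x | ¬ Occurs m x a} :=
      mul_nonneg (mul_nonneg (by linarith) (cylProb_nonneg P a)) h4
    linarith

/-- Combines `1 - p ≤ exp (-p)` with `exp (n p) ≥ n p`. -/
theorem one_sub_pow_le_inv {p : ℝ} (hp : 0 < p) (hp1 : p ≤ 1) {n : ℕ} (hn : 0 < n) :
    (1 - p) ^ n ≤ 1 / (n * p) := by
  have hn' : (0 : ℝ) < n := by exact_mod_cast hn
  have h1 : (1 - p) ^ n ≤ Real.exp (-p) ^ n :=
    pow_le_pow_left₀ (by linarith) (by linarith [Real.add_one_le_exp (-p)]) n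
  rw [← Real.exp_nat_mul] at h1
  refine h1.trans ?_
  rw [mul_neg, Real.exp_neg, one_div]
  exact inv_anti₀ (by positivity) (by linarith [Real.add_one_le_exp (n * p)])

/-- Decay of the probability that a word does not occur, under selective lower decoupling. -/
theorem measureReal_not_occurs_le {P : Measure (ℕ → A)} [IsProbabilityMeasure P]
    (hP : MeasurePreserving shift P P) {l t : ℕ} (hl : 1 ≤ l) {c : ℝ} (hc : 0 < c) (hc1 : c ≤ 1)
    {a : Fin l → A} (ha : a ∈ wordSupp P l)
    (hsld : ∀ m, 1 ≤ m → ∀ b ∈ wordSupp P m, ∃ i, i ≤ t ∧ ∃ ξ ∈ wordSupp P i,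
        c * (cylProb P a * cylProb P b) ≤ cylProb P (concat3 a ξ b)) {N : ℕ}
    (hN : 2 * (l + t) ≤ N) :
    P.real {x | ¬ Occurs N x a} ≤ 4 * (l + t) / (N * (c * cylProb P a)) := by
  have ha0 : 0 < cylProb P a := ha
  have hp0 : 0 < c * cylProb P a := mul_pos hc ha0
  have hp1 : c * cylProb P a ≤ 1 := by
    nlinarith [cylProb_le_one P a]
  set D := l + t with hD
  -- The initial `D` letters keep the window nonempty, as decoupling requires.
  have hpow : ∀ n : ℕ, P.real {x | ¬ Occurs (D + n * D) x a} ≤ (1 - c * cylProb P a) ^ n := by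
    intro n
    induction n with
    | zero => simp
    | succ n ih =>
      have h1 := measureReal_not_occurs_add_le hP (hsld (D + n * D) (by omega))
      rw [show D + n * D + (l + t) = D + (n + 1) * D by rw [← hD]; ring] at h1
      refine h1.trans ?_
      rw [pow_succ']
      exact mul_le_mul_of_nonneg_left ih (by linarith)
  have hD0 : 0 < D := by omega
  obtain ⟨n, hn⟩ : ∃ n, n + 1 = N / D :=
    ⟨N / D - 1, Nat.sub_add_cancel ((Nat.one_le_div_iff hD0).mpr (by omega))⟩
  have hn2 : 2 ≤ N / D := (Nat.le_div_iff_mul_le hD0).mpr hN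
  have hle : D + n * D ≤ N := by
    have := Nat.div_mul_le_self N D
    rw [← hn] at this
    linarith
  have hlt : N < (n + 1 + 1) * D := by
    rw [hn]
    exact (Nat.div_lt_iff_lt_mul hD0).mp (Nat.lt_succ_self _)
  have hmono : P.real {x | ¬ Occurs N x a} ≤ P.real {x | ¬ Occurs (D + n * D) x a} :=
    measureReal_mono fun x hx ho => hx (ho.mono hle)
  refine hmono.trans ((hpow n).trans ((one_sub_pow_le_inv hp0 hp1 (by omega)).trans ?_))
  have hNpos : (0 : ℝ) < N := by
    have : 0 < N := by omega
    exact_mod_cast this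
  have hnpos : (1 : ℝ) ≤ n := by
    have : 1 ≤ n := by omega
    exact_mod_cast this
  have hlt' : (N : ℝ) ≤ (n + 1 + 1) * D := by exact_mod_cast hlt.le
  have hD' : (0 : ℝ) < D := by exact_mod_cast hD0
  have h4 : (N : ℝ) ≤ 4 * D * n := by nlinarith
  have hDc : ((l : ℝ) + t) = D := by rw [hD]; push_cast; ring
  rw [hDc, div_le_div_iff₀ (by positivity) (by positivity)]
  nlinarith

end Measure

/-! ### Exponential moments and the cross entropy. -/

section Pressure

variable {A : Type*} [MeasurableSpace A] [Fintype A]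

open Classical in
/-- The sum `∑_{a ∈ supp P_n} P[a]^{-α} Q[a]`. -/
noncomputable def momentSum (P Q : Measure (ℕ → A)) (α : ℝ) (n : ℕ) : ℝ :=
  ∑ a : Fin n → A with a ∈ wordSupp P n, cylProb P a ^ (-α) * cylProb Q a

/-- The mean of `-ln P[x_1^n]` under `Q`. -/
noncomputable def meanInfo (P Q : Measure (ℕ → A)) (n : ℕ) : ℝ :=
  ∑ a : Fin n → A, cylProb Q a * -Real.log (cylProb P a)

theorem eventually_momentSum_le_exp {P Q : Measure (ℕ → A)} {α c : ℝ}
    (h : ∀ᶠ n in atTop, pressureSeq P Q α n < (c : EReal)) :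
    ∀ᶠ n : ℕ in atTop, momentSum P Q α n ≤ Real.exp (c * n) := by
  filter_upwards [h, eventually_gt_atTop 0] with n hn hn0
  by_contra! hlt
  have hn0' : (0 : EReal) < (n : EReal) := by exact_mod_cast hn0
  have h1 : ENNReal.log (ENNReal.ofReal (momentSum P Q α n)) / (n : EReal) < (c : EReal) := hn
  rw [EReal.div_lt_iff hn0' (EReal.natCast_ne_top n)] at h1
  have h2 : ENNReal.log (ENNReal.ofReal (Real.exp (c * n))) ≤
      ENNReal.log (ENNReal.ofReal (momentSum P Q α n)) :=
    ENNReal.log_le_log (ENNReal.ofReal_le_ofReal hlt.le)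
  rw [ENNReal.log_ofReal_of_pos (Real.exp_pos _), Real.log_exp, EReal.coe_mul] at h2
  exact absurd (h2.trans_lt h1) (lt_irrefl _)

theorem cylProb_eq_zero_of_notMem {P Q : Measure (ℕ → A)} [IsProbabilityMeasure Q]
    (h : seqSupp Q ⊆ seqSupp P) {n : ℕ} {a : Fin n → A} (ha : a ∉ wordSupp P n) :
    cylProb Q a = 0 := by
  by_contra h0
  exact ha (wordSupp_subset h (lt_of_le_of_ne (cylProb_nonneg Q a) (Ne.symm h0)))

variable [MeasurableSingletonClass A]

theorem momentSum_zero {P Q : Measure (ℕ → A)} [IsProbabilityMeasure Q]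
    (h : seqSupp Q ⊆ seqSupp P) (n : ℕ) : momentSum P Q 0 n = 1 := by
  classical
  rw [← sum_cylProb Q n, momentSum, Finset.sum_filter]
  refine Finset.sum_congr rfl fun a _ => ?_
  split_ifs with ha
  · simp
  · exact (cylProb_eq_zero_of_notMem h ha).symm

/-- Jensen's inequality for `exp` with weights `Q[a]`; words outside `supp P` have weight zero. -/
theorem exp_mul_meanInfo_le {P Q : Measure (ℕ → A)} [IsProbabilityMeasure Q]
    (h : seqSupp Q ⊆ seqSupp P) (α : ℝ) (n : ℕ) :
    Real.exp (α * meanInfo P Q n) ≤ momentSum P Q α n := by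
  classical
  have h1 := convexOn_exp.map_sum_le (t := (Finset.univ : Finset (Fin n → A)))
    (w := fun a => cylProb Q a) (p := fun a => Real.log (cylProb P a) * -α)
    (fun a _ => cylProb_nonneg Q a) (sum_cylProb Q n) (fun a _ => Set.mem_univ _)
  have h2 : α * meanInfo P Q n =
      ∑ a : Fin n → A, cylProb Q a • (Real.log (cylProb P a) * -α) := by
    rw [meanInfo, Finset.mul_sum]
    exact Finset.sum_congr rfl fun a _ => by simp only [smul_eq_mul]; ring
  rw [h2]
  refine h1.trans_eq ?_
  rw [momentSum, Finset.sum_filter]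
  refine Finset.sum_congr rfl fun a _ => ?_
  split_ifs with ha
  · rw [Real.rpow_def_of_pos ha, smul_eq_mul, mul_comm]
  · simp [cylProb_eq_zero_of_notMem h ha]

omit [MeasurableSingletonClass A] in
theorem crossEntropySeq_eq {P Q : Measure (ℕ → A)} [IsProbabilityMeasure P]
    [IsProbabilityMeasure Q] (h : seqSupp Q ⊆ seqSupp P) (n : ℕ) :
    crossEntropySeq P Q n = ((meanInfo P Q n / n : ℝ) : EReal) := by
  have hsum : ∀ (s : Finset (Fin n → A)) (F : (Fin n → A) → ℝ),
      ∑ a ∈ s, (F a : EReal) = ((∑ a ∈ s, F a : ℝ) : EReal) := fun s F =>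
    (map_sum (⟨⟨Real.toEReal, EReal.coe_zero⟩, EReal.coe_add⟩ : ℝ →+ EReal) F s).symm
  have hterm : ∀ a : Fin n → A, (cylProb Q a : EReal) * ENNReal.log (P (cylinder a)) =
      ((cylProb Q a * Real.log (cylProb P a) : ℝ) : EReal) := by
    intro a
    by_cases ha : a ∈ wordSupp P n
    · have h1 : P (cylinder a) = ENNReal.ofReal (cylProb P a) := (ofReal_measureReal).symm
      rw [h1, ENNReal.log_ofReal_of_pos ha, EReal.coe_mul]
    · simp [cylProb_eq_zero_of_notMem h ha]
  rw [crossEntropySeq, Finset.sum_congr rfl fun a _ => hterm a, hsum, ← EReal.coe_neg,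
    EReal.coe_div, meanInfo]
  congr 2
  rw [← Finset.sum_neg_distrib]
  exact Finset.sum_congr rfl fun a _ => by ring

/-- Exponential bounds on the moments of `P[x_1^n]` under `Q` near the exponent `0`. -/
structure MomentBounds (P Q : Measure (ℕ → A)) (h : ℝ) : Prop where
  upper : ∀ ε > 0, ∃ α > 0, ∀ᶠ n : ℕ in atTop, momentSum P Q α n ≤ Real.exp (α * (h + ε) * n)
  lower : ∀ ε > 0, ∃ s > 0, s ≤ 1 ∧
    ∀ᶠ n : ℕ in atTop, momentSum P Q (-s) n ≤ Real.exp (-(s * (h - ε)) * n)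
  nondeg : ∃ c > 0, ∀ᶠ n : ℕ in atTop, momentSum P Q (-1) n ≤ Real.exp (-c * n)

omit [MeasurableSingletonClass A] in
theorem Nondegenerate.exists_momentSum_le {P Q : Measure (ℕ → A)} (h : Nondegenerate P Q) :
    ∃ c > 0, ∀ᶠ n : ℕ in atTop, momentSum P Q (-1) n ≤ Real.exp (-c * n) := by
  obtain ⟨c, hc, hc0⟩ := EReal.lt_iff_exists_real_btwn.mp h
  refine ⟨-c, by have : c < 0 := by exact_mod_cast hc0
                 linarith, ?_⟩
  simpa using eventually_momentSum_le_exp (eventually_lt_of_limsup_lt hc)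

/-- The support inclusion gives `q 0 = 0`, so `q α = α h + o(α)`: a small positive `α` yields the
upper bound, a small negative one the lower. -/
theorem momentBounds_of_hasDerivAt {P Q : Measure (ℕ → A)} [IsProbabilityMeasure Q]
    (h_nd : Nondegenerate P Q) (h_supp : seqSupp Q ⊆ seqSupp P) {q : ℝ → ℝ} {u v h : ℝ}
    (hu : u < 0) (hv : 0 < v)
    (hq : ∀ α ∈ Set.Ioo u v, Tendsto (pressureSeq P Q α) atTop (𝓝 ((q α : ℝ) : EReal)))
    (hd : HasDerivAt q h 0) : MomentBounds P Q h := by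
  have hq0 : q 0 = 0 := by
    have h1 : pressureSeq P Q 0 = fun _ => 0 := by
      funext n
      change ENNReal.log (ENNReal.ofReal (momentSum P Q 0 n)) / (n : EReal) = 0
      simp [momentSum_zero h_supp]
    have h2 := hq 0 ⟨hu, hv⟩
    rw [h1] at h2
    exact_mod_cast (tendsto_nhds_unique h2 tendsto_const_nhds)
  have hexp : ∀ α ∈ Set.Ioo u v, ∀ c, q α < c →
      ∀ᶠ n : ℕ in atTop, momentSum P Q α n ≤ Real.exp (c * n) := fun α hα c hc =>
    eventually_momentSum_le_exp ((hq α hα).eventually_lt_const (by exact_mod_cast hc))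
  have hlin : ∀ ε > 0, ∃ δ > 0, ∀ α, |α| < δ → |q α - α * h| ≤ ε * |α| := by
    intro ε hε
    have h1 := hd.isLittleO.def hε
    obtain ⟨δ, hδ, hball⟩ := Metric.eventually_nhds_iff.mp h1
    refine ⟨δ, hδ, fun α hα => ?_⟩
    have := hball (y := α) (by simpa [Real.dist_eq] using hα)
    simpa [hq0] using this
  refine ⟨fun ε hε => ?_, fun ε hε => ?_, h_nd.exists_momentSum_le⟩
  · obtain ⟨δ, hδ, hlin⟩ := hlin (ε / 2) (by linarith)
    have hm : 0 < min δ v / 2 := by have := lt_min hδ hv; linarith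
    refine ⟨min δ v / 2, hm, hexp _ ⟨by linarith, ?_⟩ _ ?_⟩
    · linarith [min_le_right δ v]
    · have h1 := hlin (min δ v / 2) (by rw [abs_of_pos hm]; linarith [min_le_left δ v])
      rw [abs_of_pos hm] at h1
      nlinarith [(abs_le.mp h1).2]
  · obtain ⟨δ, hδ, hlin⟩ := hlin (ε / 2) (by linarith)
    -- The three terms keep `-s` where the linearization is valid and where the limit exists, and
    -- keep `s ≤ 1`.
    have hm : 0 < min (min δ (-u)) 1 / 2 := by
      have := lt_min (lt_min hδ (neg_pos.mpr hu)) one_pos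
      linarith
    have hm1 := min_le_right (min δ (-u)) 1
    have hm2 := (min_le_left (min δ (-u)) 1).trans (min_le_left _ _)
    have hm3 := (min_le_left (min δ (-u)) 1).trans (min_le_right _ _)
    refine ⟨min (min δ (-u)) 1 / 2, hm, by linarith, hexp _ ⟨by linarith, by linarith⟩ _ ?_⟩
    have h1 := hlin (-(min (min δ (-u)) 1 / 2)) (by rw [abs_neg, abs_of_pos hm]; linarith)
    rw [abs_neg, abs_of_pos hm] at h1
    nlinarith [(abs_le.mp h1).2]

theorem MomentBounds.tendsto_meanInfo {P Q : Measure (ℕ → A)} [IsProbabilityMeasure Q]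
    {h : ℝ} (hb : MomentBounds P Q h) (h_supp : seqSupp Q ⊆ seqSupp P) :
    Tendsto (fun n : ℕ => meanInfo P Q n / n) atTop (𝓝 h) := by
  refine Metric.tendsto_nhds.mpr fun ε hε => ?_
  obtain ⟨α, hα, hup⟩ := hb.upper (ε / 2) (by linarith)
  obtain ⟨s, hs, -, hlo⟩ := hb.lower (ε / 2) (by linarith)
  filter_upwards [hup, hlo, eventually_gt_atTop 0] with n h1 h2 hn
  have hn' : (0 : ℝ) < n := by exact_mod_cast hn
  have h1' := Real.exp_le_exp.mp ((exp_mul_meanInfo_le h_supp α n).trans h1)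
  have h2' := Real.exp_le_exp.mp ((exp_mul_meanInfo_le h_supp (-s) n).trans h2)
  rw [mul_assoc] at h1'
  have h1'' := le_of_mul_le_mul_left h1' hα
  have h2'' : (h - ε / 2) * n ≤ meanInfo P Q n :=
    le_of_mul_le_mul_left (by linarith : s * ((h - ε / 2) * n) ≤ s * meanInfo P Q n) hs
  rw [Real.dist_eq, abs_lt, lt_sub_iff_add_lt, sub_lt_iff_lt_add, lt_div_iff₀ hn',
    div_lt_iff₀ hn']
  constructor <;> nlinarith

theorem MomentBounds.pos {P Q : Measure (ℕ → A)} [IsProbabilityMeasure Q]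
    {h : ℝ} (hb : MomentBounds P Q h) (h_supp : seqSupp Q ⊆ seqSupp P) : 0 < h := by
  obtain ⟨c, hc, hnd⟩ := hb.nondeg
  refine hc.trans_le (ge_of_tendsto (hb.tendsto_meanInfo h_supp) ?_)
  filter_upwards [hnd, eventually_gt_atTop 0] with n h1 hn
  have hn' : (0 : ℝ) < n := by exact_mod_cast hn
  have h1' := Real.exp_le_exp.mp ((exp_mul_meanInfo_le h_supp (-1) n).trans h1)
  rw [le_div_iff₀ hn']
  linarith

end Pressure

/-! ### Occurrence of a random block of `y` in `x`. -/

section Occurrence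

variable {A : Type*} [MeasurableSpace A] [Fintype A] [MeasurableSingletonClass A]
  {P Q : Measure (ℕ → A)} [IsProbabilityMeasure P] [IsProbabilityMeasure Q]

theorem measurableSet_occurs_block (k l N : ℕ) :
    MeasurableSet {p : (ℕ → A) × (ℕ → A) | Occurs N p.1 (block p.2 k l)} := by
  have : {p : (ℕ → A) × (ℕ → A) | Occurs N p.1 (block p.2 k l)} =
      ⋃ a : Fin l → A, {x | Occurs N x a} ×ˢ {y | block y k l ∈ ({a} : Set (Fin l → A))} := by
    ext p; simp
  rw [this]
  exact MeasurableSet.iUnion fun a =>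
    (measurableSet_occurs N a).prod (measurableSet_block_mem k l {a})

/-- The occurrence probability is at most `min 1 (N P[a])`, which is at most `(N P[a])^s` because `0
< s ≤ 1`. -/
theorem prod_real_occurs_le (hP : MeasurePreserving shift P P)
    (hQ : MeasurePreserving shift Q Q) {s : ℝ} (hs0 : 0 < s) (hs1 : s ≤ 1) {l : ℕ} (hl : 1 ≤ l)
    (N k : ℕ) :
    (P.prod Q).real {p | Occurs N p.1 (block p.2 k l)} ≤ (N : ℝ) ^ s * momentSum P Q (-s) l := by
  classical
  have h1 := prod_real_block_mem (P := P) hQ k (fun a : Fin l → A => {x | Occurs N x a})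
    fun a => measurableSet_occurs N a
  refine h1.trans_le ?_
  rw [momentSum, Finset.mul_sum, Finset.sum_filter]
  refine Finset.sum_le_sum fun a _ => ?_
  have h2 := measureReal_occurs_le hP N hl a
  have h3 : P.real {x | Occurs N x a} ≤ 1 := measureReal_le_one
  have h4 : P.real {x | Occurs N x a} ≤ (N : ℝ) ^ s * cylProb P a ^ s := by
    rw [← Real.mul_rpow (Nat.cast_nonneg N) (cylProb_nonneg P a)]
    rcases le_or_gt 1 (N * cylProb P a) with h5 | h5
    · exact h3.trans (Real.one_le_rpow h5 hs0.le)
    · exact h2.trans (Real.self_le_rpow_of_le_one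
        (mul_nonneg (Nat.cast_nonneg N) (cylProb_nonneg P a)) h5.le hs1)
  split_ifs with ha
  · rw [neg_neg, ← mul_assoc]
    exact mul_le_mul_of_nonneg_right h4 (cylProb_nonneg Q a)
  · have h0 : cylProb P a = 0 := le_antisymm (not_lt.mp ha) (cylProb_nonneg P a)
    rw [h0, Real.zero_rpow hs0.ne', mul_zero] at h4
    exact mul_nonpos_of_nonpos_of_nonneg h4 (cylProb_nonneg Q a)

theorem MomentBounds.exists_prod_real_occurs_le {h : ℝ} (hb : MomentBounds P Q h)
    (hP : MeasurePreserving shift P P) (hQ : MeasurePreserving shift Q Q) {ε : ℝ} (hε : 0 < ε) :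
    ∃ s > 0, ∀ᶠ l : ℕ in atTop, ∀ N k : ℕ,
      (P.prod Q).real {p | Occurs N p.1 (block p.2 k l)} ≤
        (N : ℝ) ^ s * Real.exp (-(s * (h - ε)) * l) := by
  obtain ⟨s, hs, hs1, hlo⟩ := hb.lower ε hε
  refine ⟨s, hs, ?_⟩
  filter_upwards [hlo, eventually_ge_atTop 1] with l h1 hl N k
  exact (prod_real_occurs_le hP hQ hs hs1 hl N k).trans
    (mul_le_mul_of_nonneg_left h1 (Real.rpow_nonneg (Nat.cast_nonneg N) s))

theorem MomentBounds.exists_prod_real_occurs_le_nat_mul {h : ℝ} (hb : MomentBounds P Q h)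
    (hP : MeasurePreserving shift P P) (hQ : MeasurePreserving shift Q Q) :
    ∃ c > 0, ∀ᶠ l : ℕ in atTop, ∀ N k : ℕ,
      (P.prod Q).real {p | Occurs N p.1 (block p.2 k l)} ≤ N * Real.exp (-c * l) := by
  obtain ⟨c, hc, hnd⟩ := hb.nondeg
  refine ⟨c, hc, ?_⟩
  filter_upwards [hnd, eventually_ge_atTop 1] with l h1 hl N k
  have h2 := prod_real_occurs_le hP hQ one_pos le_rfl hl N k
  rw [Real.rpow_one] at h2
  exact h2.trans (mul_le_mul_of_nonneg_left h1 (Nat.cast_nonneg N))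

/-- Words with `P[a] ≥ exp (-(h + ε/4) l)` are handled by lower decoupling; the others are rare
under `Q` by a Chernoff bound with exponent `α`, and give the second term. -/
theorem MomentBounds.exists_prod_real_not_occurs_le {h : ℝ} (hb : MomentBounds P Q h)
    (h_supp : seqSupp Q ⊆ seqSupp P) (hP : MeasurePreserving shift P P)
    (hQ : MeasurePreserving shift Q Q) (hsld : SelectivelyLowerDecoupled P) {ε : ℝ}
    (hε : 0 < ε) :
    ∃ κ > 0, ∀ᶠ l : ℕ in atTop, ∀ N k : ℕ, 4 * l ≤ N →
      (P.prod Q).real {p | ¬ Occurs N p.1 (block p.2 k l)} ≤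
        Real.exp ((h + ε) * l) / N + Real.exp (-κ * l) := by
  classical
  obtain ⟨K, τ, hK0, hK, hτ, hdec⟩ := hsld
  -- The gap between `ε/8` and the threshold `ε/4` produces `κ = α ε/8`. The factors `exp (K l)` and
  -- `8 l` cost a further `ε/4` each.
  obtain ⟨α, hα, hup⟩ := hb.upper (ε / 8) (by linarith)
  refine ⟨α * (ε / 8), by positivity, ?_⟩
  have h8 : ∀ᶠ l : ℕ in atTop, 8 * (l : ℝ) ≤ Real.exp (ε / 4 * l) := by
    have h1 : Tendsto (fun x : ℝ => Real.exp (ε / 4 * x) / x) atTop atTop := by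
      simpa using tendsto_exp_mul_div_rpow_atTop 1 (ε / 4) (by linarith)
    filter_upwards [(h1.comp tendsto_natCast_atTop_atTop).eventually_ge_atTop 8,
      eventually_gt_atTop 0] with l hl hl0
    exact (le_div_iff₀ (by exact_mod_cast hl0)).mp hl
  filter_upwards [hup, h8, hK.def (show (0 : ℝ) < ε / 4 by linarith), hτ.def one_pos,
    eventually_ge_atTop 1] with l hup h8 hKl hτl hl N k hN
  have hl0 : (0 : ℝ) < l := by exact_mod_cast hl
  have hN0 : (0 : ℝ) < N := by
    have : 0 < N := by omega
    exact_mod_cast this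
  have hKl' : K l ≤ ε / 4 * l := by simpa [abs_of_nonneg (hK0 l)] using hKl
  have hτl' : (τ l : ℝ) ≤ l := by simpa using hτl
  have hτn : τ l ≤ l := by exact_mod_cast hτl'
  have h1 := prod_real_block_mem (P := P) hQ k (fun a : Fin l → A => {x | ¬ Occurs N x a})
    fun a => (measurableSet_occurs N a).compl
  refine h1.trans_le ?_
  have hterm : ∀ a : Fin l → A, P.real {x | ¬ Occurs N x a} * cylProb Q a ≤
      Real.exp ((h + ε) * l) / N * cylProb Q a + Real.exp (-(α * (h + ε / 4)) * l) *
        (if a ∈ wordSupp P l then cylProb P a ^ (-α) * cylProb Q a else 0) := by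
    intro a
    split_ifs with ha
    · have ha0 : 0 < cylProb P a := ha
      rw [← mul_assoc, ← add_mul]
      refine mul_le_mul_of_nonneg_right ?_ (cylProb_nonneg Q a)
      rcases le_or_gt (Real.exp (-((h + ε / 4) * l))) (cylProb P a) with h2 | h2
      · refine le_add_of_le_of_nonneg ?_ (by positivity)
        have h3 := measureReal_not_occurs_le hP hl (Real.exp_pos (-K l))
          (Real.exp_le_one_iff.mpr (by linarith [hK0 l])) ha (hdec l hl a ha) (N := N) (by omega)
        refine h3.trans ?_
        have h4 : Real.exp (-(ε / 4 * l)) * Real.exp (-((h + ε / 4) * l)) ≤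
            Real.exp (-K l) * cylProb P a :=
          mul_le_mul (Real.exp_le_exp.mpr (by linarith)) h2 (Real.exp_pos _).le
            (Real.exp_pos _).le
        rw [← Real.exp_add] at h4
        rw [div_le_div_iff₀ (by positivity) hN0]
        have h5 : 4 * ((l : ℝ) + τ l) ≤ Real.exp ((h + ε) * l) *
            (Real.exp (-K l) * cylProb P a) := by
          calc 4 * ((l : ℝ) + τ l) ≤ Real.exp (ε / 4 * l) := by linarith
            _ ≤ Real.exp ((h + ε) * l) *
                Real.exp (-(ε / 4 * l) + -((h + ε / 4) * l)) := by
              rw [← Real.exp_add]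
              exact Real.exp_le_exp.mpr (by nlinarith)
            _ ≤ _ := mul_le_mul_of_nonneg_left h4 (Real.exp_pos _).le
        nlinarith
      · refine le_add_of_nonneg_of_le (by positivity) (measureReal_le_one.trans ?_)
        have h3 := Real.rpow_le_rpow_of_nonpos ha0 h2.le (neg_nonpos.mpr hα.le)
        rw [← Real.exp_mul] at h3
        calc (1 : ℝ) = Real.exp (-(α * (h + ε / 4)) * l) *
              Real.exp (-((h + ε / 4) * l) * -α) := by
                rw [← Real.exp_add, ← Real.exp_zero]; congr 1; ring
          _ ≤ _ := mul_le_mul_of_nonneg_left h3 (Real.exp_pos _).le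
    · simp [cylProb_eq_zero_of_notMem h_supp ha]
  refine (Finset.sum_le_sum fun a _ => hterm a).trans ?_
  rw [Finset.sum_add_distrib, ← Finset.mul_sum, ← Finset.mul_sum, sum_cylProb, mul_one,
    ← Finset.sum_filter]
  refine add_le_add le_rfl ?_
  calc _ ≤ Real.exp (-(α * (h + ε / 4)) * l) * Real.exp (α * (h + ε / 8) * l) :=
        mul_le_mul_of_nonneg_left hup (Real.exp_pos _).le
    _ = _ := by rw [← Real.exp_add]; congr 1; ring

end Occurrence

/-! ### Borel–Cantelli along dyadic scales. -/

section Counting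

open Classical in
/-- Events of exponentially small probability rarely occur along dyadic ranges of indices. -/
theorem ae_eventually_card_le {Ω : Type*} [MeasurableSpace Ω] {μ : Measure Ω}
    [IsProbabilityMeasure μ] {B : ℕ → ℕ → Set Ω} (hB : ∀ j k, MeasurableSet (B j k)) {κ : ℝ}
    (hκ : 0 < κ) (h : ∀ᶠ j : ℕ in atTop, ∀ k, μ.real (B j k) ≤ Real.exp (-κ * j)) :
    ∀ᵐ ω ∂μ, ∀ᶠ j : ℕ in atTop,
      (((Finset.range (2 ^ (j + 1))).filter fun k => ω ∈ B j k).card : ℝ) ≤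
        2 ^ (j + 1) * Real.exp (-(κ / 2) * j) := by
  obtain ⟨j₀, hj₀⟩ := eventually_atTop.mp h
  set f : ℕ → Ω → ℝ := fun j ω =>
    ∑ k ∈ Finset.range (2 ^ (j + 1)), (B j k).indicator (fun _ => (1 : ℝ)) ω with hf
  have hcard : ∀ j ω,
      (((Finset.range (2 ^ (j + 1))).filter fun k => ω ∈ B j k).card : ℝ) = f j ω := by
    intro j ω
    simp only [hf, Set.indicator_apply, Finset.sum_boole]
  -- In Markov's inequality half of the rate `κ` goes into the threshold; the other half makes the
  -- probabilities summable.
  set S : ℕ → Set Ω := fun j => {ω | 2 ^ (j + 1) * Real.exp (-(κ / 2) * j) ≤ f j ω} with hS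
  have hint : ∀ j k, Integrable ((B j k).indicator fun _ => (1 : ℝ)) μ := fun j k =>
    (integrable_const 1).indicator (hB j k)
  have hle : ∀ j ≥ j₀, μ.real (S j) ≤ Real.exp (j * (-(κ / 2))) := by
    intro j hj
    have h1 := mul_meas_ge_le_integral_of_nonneg (μ := μ) (f := f j)
      (ae_of_all _ fun ω => Finset.sum_nonneg fun k _ =>
        Set.indicator_nonneg (fun _ _ => zero_le_one) ω)
      (integrable_finsetSum _ fun k _ => hint j k) (2 ^ (j + 1) * Real.exp (-(κ / 2) * j))
    have h2 : ∫ ω, f j ω ∂μ ≤ 2 ^ (j + 1) * Real.exp (-κ * j) := by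
      rw [integral_finsetSum _ fun k _ => hint j k]
      calc _ ≤ ∑ k ∈ Finset.range (2 ^ (j + 1)), Real.exp (-κ * j) := by
            refine Finset.sum_le_sum fun k _ => ?_
            have : ∫ ω, (B j k).indicator (fun _ => (1 : ℝ)) ω ∂μ = μ.real (B j k) :=
              integral_indicator_one (hB j k)
            rw [this]
            exact hj₀ j hj k
        _ = _ := by simp
    have h3 : Real.exp (-κ * j) = Real.exp (-(κ / 2) * j) * Real.exp (j * (-(κ / 2))) := by
      rw [← Real.exp_add]; congr 1; ring
    rw [h3, ← mul_assoc] at h2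
    exact le_of_mul_le_mul_left (h1.trans h2) (by positivity)
  have hsum : Summable fun j : ℕ => Real.exp (((j + j₀ : ℕ) : ℝ) * (-(κ / 2))) :=
    (summable_nat_add_iff j₀).mpr (Real.summable_exp_nat_mul_iff.mpr (by linarith))
  have hne : ∑' j, μ (S (j + j₀)) ≠ ⊤ := by
    refine ne_top_of_le_ne_top (hsum.tsum_ofReal_ne_top) (ENNReal.tsum_le_tsum fun j => ?_)
    rw [← ofReal_measureReal (μ := μ) (s := S (j + j₀))]
    exact ENNReal.ofReal_le_ofReal (hle _ (Nat.le_add_left _ _))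
  filter_upwards [ae_eventually_notMem hne] with ω hω
  obtain ⟨j₁, hj₁⟩ := eventually_atTop.mp hω
  filter_upwards [eventually_ge_atTop (j₀ + j₁)] with j hj
  have h1 := hj₁ (j - j₀) (by omega)
  rw [Nat.sub_add_cancel (by omega)] at h1
  rw [hcard]
  exact (not_le.mp h1).le

theorem eventually_of_eventually_dyadic {p : ℕ → Prop}
    (h : ∀ᶠ j in atTop, ∀ N, 2 ^ j ≤ N → N < 2 ^ (j + 1) → p N) : ∀ᶠ N in atTop, p N := by
  obtain ⟨j₀, hj₀⟩ := eventually_atTop.mp h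
  filter_upwards [eventually_ge_atTop (2 ^ j₀)] with N hN
  have hN0 : N ≠ 0 := by have := Nat.two_pow_pos j₀; omega
  exact hj₀ (Nat.log 2 N) (Nat.le_log_of_pow_le one_lt_two hN) N (Nat.pow_log_le_self 2 hN0)
    (Nat.lt_pow_succ_log_self one_lt_two N)

theorem two_pow_eq_exp (j : ℕ) : (2 : ℝ) ^ j = Real.exp (j * Real.log 2) := by
  rw [Real.exp_nat_mul, Real.exp_log two_pos]

theorem tendsto_nat_mul_exp_neg {κ : ℝ} (hκ : 0 < κ) :
    Tendsto (fun j : ℕ => (j : ℝ) * Real.exp (-κ * j)) atTop (𝓝 0) := by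
  have h1 := tendsto_rpow_mul_exp_neg_mul_atTop_nhds_zero 1 κ hκ
  simp only [Real.rpow_one] at h1
  exact h1.comp tendsto_natCast_atTop_atTop

theorem tendsto_exp_neg_mul_nat {κ : ℝ} (hκ : 0 < κ) :
    Tendsto (fun j : ℕ => Real.exp (-κ * j)) atTop (𝓝 0) := by
  have h1 : Tendsto (fun x : ℝ => Real.exp (-(κ * x))) atTop (𝓝 0) :=
    Real.tendsto_exp_neg_atTop_nhds_zero.comp (tendsto_id.const_mul_atTop hκ)
  simpa [Function.comp_def] using h1.comp (tendsto_natCast_atTop_atTop (R := ℝ))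

theorem log_le_of_lt_two_pow {N j : ℕ} (hN0 : 0 < N) (hN : N < 2 ^ (j + 1)) :
    Real.log N ≤ (j + 1) * Real.log 2 := by
  have h1 : (N : ℝ) ≤ 2 ^ (j + 1) := by exact_mod_cast hN.le
  have h2 := Real.log_le_log (by exact_mod_cast hN0) h1
  rwa [Real.log_pow, Nat.cast_add_one] at h2

theorem mul_log_two_le_log {N j : ℕ} (hN : 2 ^ j ≤ N) : j * Real.log 2 ≤ Real.log N := by
  have h1 : (2 : ℝ) ^ j ≤ N := by exact_mod_cast hN
  have h2 := Real.log_le_log (by positivity) h1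
  rwa [Real.log_pow] at h2

/-- Dividing by `ln N` gives `c_N / N → 0`, so `N - c_N` may replace `N` in the denominator. -/
theorem tendsto_mZMEstimator {A : Type*} {x y : ℕ → A} {h : ℝ}
    (hlim : Tendsto (fun N : ℕ => (wordCount N y x : ℝ) * Real.log N / N) atTop (𝓝 h)) :
    Tendsto (fun N : ℕ => mZMEstimator N y x) atTop (𝓝 h) := by
  have hlog : Tendsto (fun N : ℕ => Real.log N) atTop atTop :=
    Real.tendsto_log_atTop.comp tendsto_natCast_atTop_atTop
  have h1 := hlim.mul hlog.inv_tendsto_atTop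
  have h2 := hlim.div (h1.const_sub 1) (by simp)
  simp only [mul_zero, sub_zero, div_one] at h2
  refine h2.congr' ?_
  filter_upwards [hlog.eventually_gt_atTop 0, eventually_gt_atTop 0] with N hN hN0
  have hN0' : (0 : ℝ) < N := by exact_mod_cast hN0
  have h3 : (wordCount N y x : ℝ) * Real.log N / N * (Real.log N)⁻¹ = wordCount N y x / N := by
    field_simp
  simp only [Pi.inv_apply, Pi.div_apply, h3, mZMEstimator]
  rw [one_sub_div hN0'.ne', div_div_div_cancel_right₀ hN0'.ne']

end Counting

/-! ### Almost sure upper and lower bounds. -/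

section Estimates

variable {A : Type*} [MeasurableSpace A] [Fintype A] [MeasurableSingletonClass A]
  {P Q : Measure (ℕ → A)} [IsProbabilityMeasure P] [IsProbabilityMeasure Q]

/-- Almost surely, `c_N ln N / N` is eventually at most `h + ε`. -/
theorem MomentBounds.ae_eventually_le {h : ℝ} (hb : MomentBounds P Q h)
    (h_supp : seqSupp Q ⊆ seqSupp P) (hP : MeasurePreserving shift P P)
    (hQ : MeasurePreserving shift Q Q) (hsld : SelectivelyLowerDecoupled P) {ε : ℝ}
    (hε : 0 < ε) :
    ∀ᵐ p ∂(P.prod Q), ∀ᶠ N : ℕ in atTop,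
      (wordCount N p.2 p.1 : ℝ) * Real.log N / N ≤ h + ε := by
  classical
  have hh := hb.pos h_supp
  have hlog2 : 0 < Real.log 2 := Real.log_pos one_lt_two
  -- Blocks of length about `ρ j` are slightly shorter than `ln (2^j) / h`, so they should occur in
  -- `2^j` letters.
  set ρ := Real.log 2 / (h + ε / 2) with hρ
  have hρ0 : 0 < ρ := by positivity
  have hρh : ρ * (h + ε / 2) = Real.log 2 := div_mul_cancel₀ _ (by positivity)
  set r : ℕ → ℕ := fun j => ⌊ρ * j⌋₊ with hr
  have hrle : ∀ j, (r j : ℝ) ≤ ρ * j := fun j => Nat.floor_le (by positivity)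
  have hrlt : ∀ j, ρ * j < r j + 1 := fun j => Nat.lt_floor_add_one _
  have hrtop : Tendsto r atTop atTop :=
    tendsto_nat_floor_atTop.comp (tendsto_natCast_atTop_atTop.const_mul_atTop hρ0)
  obtain ⟨κ, hκ, hprob⟩ :=
    hb.exists_prod_real_not_occurs_le h_supp hP hQ hsld (show 0 < ε / 4 by linarith)
  -- Both error terms decay at rate `2 κ'`; the spare factor `exp (-κ' j)` absorbs `1 + exp κ`,
  -- where `exp κ` comes from the floor.
  set κ' := min (ρ * (ε / 4)) (κ * ρ) / 2 with hκ'
  have hκ'0 : 0 < κ' := by positivity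
  have hκ1 : 2 * κ' ≤ ρ * (ε / 4) := by
    rw [hκ']; linarith [min_le_left (ρ * (ε / 4)) (κ * ρ)]
  have hκ2 : 2 * κ' ≤ κ * ρ := by
    rw [hκ']; linarith [min_le_right (ρ * (ε / 4)) (κ * ρ)]
  have hsmall : ∀ᶠ j : ℕ in atTop, ∀ k, (P.prod Q).real
      {p | ¬ Occurs (2 ^ j) p.1 (block p.2 k (r j))} ≤ Real.exp (-κ' * j) := by
    have h4 : ∀ᶠ j : ℕ in atTop, 4 * ρ * (j * Real.exp (-Real.log 2 * j)) < 1 := by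
      have := (tendsto_nat_mul_exp_neg hlog2).const_mul (4 * ρ)
      rw [mul_zero] at this
      exact this.eventually_lt_const one_pos
    have h5 : ∀ᶠ j : ℕ in atTop, (1 + Real.exp κ) * Real.exp (-κ' * j) < 1 := by
      have := (tendsto_exp_neg_mul_nat hκ'0).const_mul (1 + Real.exp κ)
      rw [mul_zero] at this
      exact this.eventually_lt_const one_pos
    filter_upwards [hrtop.eventually hprob, h4, h5] with j hj h4 h5 k
    have hpow : (((2 ^ j : ℕ)) : ℝ) = Real.exp (j * Real.log 2) := by
      rw [← two_pow_eq_exp]; push_cast; ring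
    have hle : 4 * r j ≤ 2 ^ j := by
      have h6 : (4 : ℝ) * r j ≤ ((2 ^ j : ℕ) : ℝ) := by
        rw [hpow]
        have h7 : Real.exp (-Real.log 2 * j) * Real.exp (j * Real.log 2) = 1 := by
          rw [← Real.exp_add, ← Real.exp_zero]; congr 1; ring
        have h8 : 4 * ρ * (j * Real.exp (-Real.log 2 * j)) * Real.exp (j * Real.log 2) ≤
            1 * Real.exp (j * Real.log 2) :=
          mul_le_mul_of_nonneg_right h4.le (Real.exp_pos _).le
        have h9 : 4 * ρ * (j * Real.exp (-Real.log 2 * j)) * Real.exp (j * Real.log 2) =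
            4 * ρ * j := by
          rw [show 4 * ρ * (j * Real.exp (-Real.log 2 * j)) * Real.exp (j * Real.log 2) =
            4 * ρ * j * (Real.exp (-Real.log 2 * j) * Real.exp (j * Real.log 2)) by ring, h7,
            mul_one]
        linarith [hrle j]
      exact_mod_cast h6
    refine (hj _ k hle).trans ?_
    have e1 : Real.exp ((h + ε / 4) * r j) / ((2 ^ j : ℕ) : ℝ) ≤ Real.exp (-(2 * κ') * j) := by
      rw [hpow, ← Real.exp_sub]
      refine Real.exp_le_exp.mpr ?_
      have h6 : (h + ε / 4) * r j ≤ (h + ε / 4) * (ρ * j) :=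
        mul_le_mul_of_nonneg_left (hrle j) (by linarith)
      have h7 : 2 * κ' * j ≤ ρ * (ε / 4) * j :=
        mul_le_mul_of_nonneg_right hκ1 (Nat.cast_nonneg j)
      rw [← hρh]
      linarith
    have e2 : Real.exp (-κ * r j) ≤ Real.exp κ * Real.exp (-(2 * κ') * j) := by
      rw [← Real.exp_add]
      refine Real.exp_le_exp.mpr ?_
      have h6 : κ * (ρ * j) ≤ κ * (r j + 1) := mul_le_mul_of_nonneg_left (hrlt j).le hκ.le
      have h7 : 2 * κ' * j ≤ κ * ρ * j := mul_le_mul_of_nonneg_right hκ2 (Nat.cast_nonneg j)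
      linarith
    have e3 : Real.exp (-(2 * κ') * j) = Real.exp (-κ' * j) * Real.exp (-κ' * j) := by
      rw [← Real.exp_add]; congr 1; ring
    have e4 := mul_le_mul_of_nonneg_right h5.le (Real.exp_pos (-κ' * j)).le
    rw [e3] at e1 e2
    linarith
  -- The window `2^j ≤ N` is the shortest in the dyadic range, and positions run up to `2^(j+1)`, so
  -- one event serves every `N` in the range.
  have hBC := ae_eventually_card_le (μ := P.prod Q)
    (B := fun j k => {p | ¬ Occurs (2 ^ j) p.1 (block p.2 k (r j))})
    (fun j k => (measurableSet_occurs_block k (r j) (2 ^ j)).compl) hκ'0 hsmall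
  have hlim : ∀ᶠ j : ℕ in atTop, 0 < j ∧ (j + 1) * Real.log 2 / (ρ * j) +
      (j + 1) * Real.log 2 * (Real.exp (-Real.log 2 * j) + 2 * Real.exp (-(κ' / 2) * j)) <
      h + ε := by
    have hmul : ∀ c : ℝ, 0 < c →
        Tendsto (fun j : ℕ => ((j : ℝ) + 1) * Real.exp (-c * j)) atTop (𝓝 0) := by
      intro c hc
      have := (tendsto_nat_mul_exp_neg hc).add (tendsto_exp_neg_mul_nat hc)
      rw [add_zero] at this
      exact this.congr fun j => by ring
    have t1 : Tendsto (fun j : ℕ => (h + ε / 2) * (1 + 1 / (j : ℝ))) atTop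
        (𝓝 ((h + ε / 2) * (1 + 0))) :=
      (tendsto_one_div_atTop_nhds_zero_nat.const_add 1).const_mul _
    have t2 := (t1.add ((hmul _ hlog2).const_mul (Real.log 2))).add
      ((hmul (κ' / 2) (by linarith)).const_mul (2 * Real.log 2))
    have hlt : (h + ε / 2) * (1 + 0) + Real.log 2 * 0 + 2 * Real.log 2 * 0 < h + ε := by linarith
    filter_upwards [t2.eventually_lt_const hlt, eventually_gt_atTop 0] with j hj hj0
    refine ⟨hj0, lt_of_eq_of_lt ?_ hj⟩
    have hj0' : (j : ℝ) ≠ 0 := by exact_mod_cast hj0.ne'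
    have : (j + 1) * Real.log 2 / (ρ * j) = (h + ε / 2) * (1 + 1 / (j : ℝ)) := by
      rw [← hρh]
      field_simp
    rw [this]
    ring
  filter_upwards [hBC] with p hp
  refine eventually_of_eventually_dyadic ?_
  filter_upwards [hp, hlim] with j hj ⟨hj0, hlim⟩ N hN1 hN2
  have hj0' : (0 : ℝ) < j := by exact_mod_cast hj0
  have hN0 : 0 < N := (Nat.two_pow_pos j).trans_le hN1
  have hN0' : (0 : ℝ) < N := by exact_mod_cast hN0
  have hN1' : (2 : ℝ) ^ j ≤ N := by exact_mod_cast hN1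
  have hcount := wordCount_mul_le (N := N) (r := r j) (y := p.2) (x := p.1)
  set b := ((Finset.range N).filter fun k => ¬ Occurs N p.1 (block p.2 k (r j))).card
  have hbb : (b : ℝ) ≤ 2 ^ (j + 1) * Real.exp (-(κ' / 2) * j) := by
    refine le_trans ?_ hj
    refine Nat.cast_le.mpr (Finset.card_le_card fun k hk => ?_)
    simp only [Finset.mem_filter, Finset.mem_range] at hk ⊢
    exact ⟨hk.1.trans hN2, fun ho => hk.2 (ho.mono hN1)⟩
  have hcount' : (wordCount N p.2 p.1 : ℝ) * (r j + 1) ≤ N + (r j + 1) + (r j + 1) * b := by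
    exact_mod_cast hcount
  have hr1 : (0 : ℝ) < r j + 1 := by positivity
  have hc : (wordCount N p.2 p.1 : ℝ) ≤ N / (ρ * j) + 1 + b := by
    have h1 : (wordCount N p.2 p.1 : ℝ) ≤ N / (r j + 1) + 1 + b := by
      rw [← mul_le_mul_iff_left₀ hr1]
      refine hcount'.trans_eq ?_
      field_simp
    have h2 : (N : ℝ) / (r j + 1) ≤ N / (ρ * j) :=
      div_le_div_of_nonneg_left hN0'.le (by positivity) (hrlt j).le
    linarith
  have hone : 1 ≤ N * Real.exp (-Real.log 2 * j) := by
    calc (1 : ℝ) = 2 ^ j * Real.exp (-Real.log 2 * j) := by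
          rw [two_pow_eq_exp, ← Real.exp_add, ← Real.exp_zero]; congr 1; ring
      _ ≤ _ := mul_le_mul_of_nonneg_right hN1' (Real.exp_pos _).le
  have hbN : (b : ℝ) ≤ N * (2 * Real.exp (-(κ' / 2) * j)) := by
    refine hbb.trans ?_
    rw [pow_succ, mul_assoc]
    exact mul_le_mul_of_nonneg_right hN1' (by positivity)
  have hcN : (wordCount N p.2 p.1 : ℝ) ≤
      N * (1 / (ρ * j) + (Real.exp (-Real.log 2 * j) + 2 * Real.exp (-(κ' / 2) * j))) := by
    have : (N : ℝ) * (1 / (ρ * j)) = N / (ρ * j) := by ring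
    rw [mul_add, mul_add, this]
    linarith
  have hlogN := log_le_of_lt_two_pow hN0 hN2
  rw [div_le_iff₀ hN0']
  calc (wordCount N p.2 p.1 : ℝ) * Real.log N
      ≤ N * (1 / (ρ * j) + (Real.exp (-Real.log 2 * j) + 2 * Real.exp (-(κ' / 2) * j))) *
        ((j + 1) * Real.log 2) :=
        mul_le_mul hcN hlogN (Real.log_natCast_nonneg N) (by positivity)
    _ = ((j + 1) * Real.log 2 / (ρ * j) + (j + 1) * Real.log 2 *
        (Real.exp (-Real.log 2 * j) + 2 * Real.exp (-(κ' / 2) * j))) * N := by ring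
    _ ≤ (h + ε) * N := mul_le_mul_of_nonneg_right hlim.le hN0'.le

/-- Almost surely, `c_N ln N / N` is eventually at least `h - ε`. -/
theorem MomentBounds.ae_eventually_ge {h : ℝ} (hb : MomentBounds P Q h)
    (hP : MeasurePreserving shift P P) (hQ : MeasurePreserving shift Q Q) {ε : ℝ}
    (hε : 0 < ε) (hεh : ε < h) :
    ∀ᵐ p ∂(P.prod Q), ∀ᶠ N : ℕ in atTop,
      h - ε ≤ (wordCount N p.2 p.1 : ℝ) * Real.log N / N := by
  classical
  have hlog2 : 0 < Real.log 2 := Real.log_pos one_lt_two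
  obtain ⟨ρ, hρ⟩ : ∃ ρ, ρ = Real.log 2 / (h - ε / 2) := ⟨_, rfl⟩
  have hhε : 0 < h - ε / 2 := by linarith
  have hρ0 : 0 < ρ := by rw [hρ]; positivity
  have hρh : ρ * (h - ε / 2) = Real.log 2 := by rw [hρ]; exact div_mul_cancel₀ _ hhε.ne'
  obtain ⟨s, hs, hprob⟩ := hb.exists_prod_real_occurs_le hP hQ (show 0 < ε / 4 by linarith)
  obtain ⟨c, hc, hprob1⟩ := hb.exists_prod_real_occurs_le_nat_mul hP hQ
  set R : ℕ → ℕ := fun j => ⌈ρ * j⌉₊ with hR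
  -- With `c M ≥ 5` the rate beats the window size `2^(j+1) ≤ exp (2 j)` and leaves `exp (-3 j)`.
  obtain ⟨M, hM⟩ : ∃ M : ℕ, 5 / c ≤ M := exists_nat_ge _
  have hcM : 5 ≤ c * M := by rwa [div_le_iff₀' hc] at hM
  have hM0 : 0 < M := by
    rcases Nat.eq_zero_or_pos M with h0 | h0
    · rw [h0] at hcM; norm_num at hcM
    · exact h0
  have hRge : ∀ j, ρ * j ≤ R j := fun j => Nat.le_ceil _
  have hRlt : ∀ j, (R j : ℝ) < ρ * j + 1 := fun j => Nat.ceil_lt_add_one (by positivity)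
  have hRtop : Tendsto R atTop atTop :=
    tendsto_nat_ceil_atTop.comp (tendsto_natCast_atTop_atTop.const_mul_atTop hρ0)
  have hMtop : Tendsto (fun j : ℕ => M * j) atTop atTop :=
    tendsto_id.const_mul_atTop' hM0
  have hpow : ∀ j : ℕ, (((2 ^ (j + 1) : ℕ)) : ℝ) = Real.exp ((j + 1) * Real.log 2) := by
    intro j
    rw [← Nat.cast_add_one, ← two_pow_eq_exp]; push_cast; ring
  set κ := s * (ρ * (ε / 4)) / 2 with hκ
  have hκ0 : 0 < κ := by positivity
  have hsmall : ∀ᶠ j : ℕ in atTop, ∀ k, (P.prod Q).real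
      {p | Occurs (2 ^ (j + 1)) p.1 (block p.2 k (R j))} ≤ Real.exp (-κ * j) := by
    have h5 : ∀ᶠ j : ℕ in atTop, s * Real.log 2 ≤ κ * j :=
      (tendsto_natCast_atTop_atTop.const_mul_atTop hκ0).eventually_ge_atTop _
    filter_upwards [hRtop.eventually hprob, h5] with j hj h5 k
    refine (hj _ k).trans ?_
    rw [hpow, ← Real.exp_mul, ← Real.exp_add]
    refine Real.exp_le_exp.mpr ?_
    have h6 : s * (h - ε / 4) * (ρ * j) ≤ s * (h - ε / 4) * R j :=
      mul_le_mul_of_nonneg_left (hRge j) (mul_nonneg hs.le (by linarith))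
    have h7 : κ * 2 = s * (ρ * (ε / 4)) := by rw [hκ]; ring
    have h8 : κ * j * 2 = s * (ρ * (ε / 4)) * j := by rw [← h7]; ring
    have h9 : Real.log 2 * s * j = s * (ρ * (h - ε / 2)) * j := by rw [hρh]; ring
    linarith
  have hsmall1 : ∀ᶠ j : ℕ in atTop, ∀ k, (P.prod Q).real
      {p | Occurs (2 ^ (j + 1)) p.1 (block p.2 k (M * j))} ≤ Real.exp (-3 * j) := by
    filter_upwards [hMtop.eventually hprob1, eventually_ge_atTop 1] with j hj h1 k
    refine (hj _ k).trans ?_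
    rw [hpow, ← Real.exp_add]
    refine Real.exp_le_exp.mpr ?_
    have h1' : (1 : ℝ) ≤ j := by exact_mod_cast h1
    have h2 : Real.log 2 ≤ 1 := by linarith [Real.log_two_lt_d9]
    have h3 : 5 * (j : ℝ) ≤ c * M * j := mul_le_mul_of_nonneg_right hcM (by linarith)
    push_cast
    nlinarith
  have hBC := ae_eventually_card_le (μ := P.prod Q)
    (B := fun j k => {p | Occurs (2 ^ (j + 1)) p.1 (block p.2 k (R j))})
    (fun j k => measurableSet_occurs_block k (R j) _) hκ0 hsmall
  have hBC1 := ae_eventually_card_le (μ := P.prod Q)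
    (B := fun j k => {p | Occurs (2 ^ (j + 1)) p.1 (block p.2 k (M * j))})
    (fun j k => measurableSet_occurs_block k (M * j) _) three_pos hsmall1
  -- An integer count below 1 vanishes: no block of length `M j` occurs at all.
  have hzero : ∀ᶠ j : ℕ in atTop, (2 : ℝ) ^ (j + 1) * Real.exp (-(3 / 2) * j) < 1 := by
    have h1 := (tendsto_exp_neg_mul_nat (κ := 3 / 2 - Real.log 2)
      (by linarith [Real.log_two_lt_d9])).const_mul 2
    rw [mul_zero] at h1
    filter_upwards [h1.eventually_lt_const one_pos] with j hj
    refine lt_of_eq_of_lt ?_ hj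
    rw [pow_succ, two_pow_eq_exp, mul_comm (Real.exp _) 2, mul_assoc, ← Real.exp_add]
    congr 2
    ring
  have hlim : ∀ᶠ j : ℕ in atTop, 2 ≤ j ∧ h - ε <
      (1 - 2 * M * (j * Real.exp (-(κ / 2) * j))) * (j * Real.log 2 / (ρ * j + 1)) := by
    have t1 : Tendsto (fun j : ℕ => 1 - 2 * M * ((j : ℝ) * Real.exp (-(κ / 2) * j))) atTop
        (𝓝 (1 - 2 * M * 0)) :=
      ((tendsto_nat_mul_exp_neg (by linarith)).const_mul _).const_sub 1
    have t2 : Tendsto (fun j : ℕ => Real.log 2 / (ρ + 1 / (j : ℝ))) atTop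
        (𝓝 (Real.log 2 / (ρ + 0))) :=
      tendsto_const_nhds.div (tendsto_one_div_atTop_nhds_zero_nat.const_add ρ)
        (by rw [add_zero]; exact hρ0.ne')
    have hval : h - ε < (1 - 2 * M * 0) * (Real.log 2 / (ρ + 0)) := by
      rw [add_zero, ← hρh, mul_div_cancel_left₀ _ hρ0.ne']
      linarith
    filter_upwards [(t1.mul t2).eventually_const_lt hval, eventually_ge_atTop 2] with j hj hj2
    refine ⟨hj2, hj.trans_eq ?_⟩
    have hj0' : (j : ℝ) ≠ 0 := by
      have : j ≠ 0 := by omega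
      exact_mod_cast this
    congr 1
    field_simp
  filter_upwards [hBC, hBC1] with p hp hp1
  refine eventually_of_eventually_dyadic ?_
  filter_upwards [hp, hp1, hzero, hlim, hRtop.eventually_ge_atTop 2]
    with j hj hj1 hzero ⟨hj2, hlim⟩ hR2 N hN1 hN2
  have hN0 : 0 < N := (Nat.two_pow_pos j).trans_le hN1
  have hN0' : (0 : ℝ) < N := by exact_mod_cast hN0
  have hN1' : (2 : ℝ) ^ j ≤ N := by exact_mod_cast hN1
  have hlong : ∀ k < N, ¬ Occurs N p.1 (block p.2 k (M * j)) := by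
    intro k hk ho
    have h0 := hj1.trans_lt hzero
    rw [Nat.cast_lt_one, Finset.card_eq_zero, Finset.filter_eq_empty_iff] at h0
    exact h0 (Finset.mem_range.mpr (hk.trans hN2)) (ho.mono hN2.le)
  have hcount := le_wordCount_mul hR2 (by nlinarith : 2 ≤ M * j) hlong
  set b := ((Finset.range N).filter fun k => Occurs N p.1 (block p.2 k (R j))).card
  have hbb : (b : ℝ) ≤ 2 ^ (j + 1) * Real.exp (-(κ / 2) * j) := by
    refine le_trans ?_ hj
    refine Nat.cast_le.mpr (Finset.card_le_card fun k hk => ?_)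
    simp only [Finset.mem_filter, Finset.mem_range] at hk ⊢
    exact ⟨hk.1.trans hN2, hk.2.mono hN2.le⟩
  have hbN : (b : ℝ) ≤ N * (2 * Real.exp (-(κ / 2) * j)) := by
    refine hbb.trans ?_
    rw [pow_succ, mul_assoc]
    exact mul_le_mul_of_nonneg_right hN1' (by positivity)
  have hcount' : (N : ℝ) ≤ wordCount N p.2 p.1 * R j + M * j * b := by exact_mod_cast hcount
  have hden : (0 : ℝ) < ρ * j + 1 := by positivity
  have h1 : (wordCount N p.2 p.1 : ℝ) * R j ≤ wordCount N p.2 p.1 * (ρ * j + 1) :=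
    mul_le_mul_of_nonneg_left (hRlt j).le (Nat.cast_nonneg _)
  have h2 : (M : ℝ) * j * b ≤ M * j * (N * (2 * Real.exp (-(κ / 2) * j))) :=
    mul_le_mul_of_nonneg_left hbN (by positivity)
  have h3 : N * (1 - 2 * M * (j * Real.exp (-(κ / 2) * j))) ≤
      wordCount N p.2 p.1 * (ρ * j + 1) := by
    have : N * (1 - 2 * M * (j * Real.exp (-(κ / 2) * j))) =
      N - M * j * (N * (2 * Real.exp (-(κ / 2) * j))) := by ring
    linarith
  rw [le_div_iff₀ hN0']
  calc (h - ε) * N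
      ≤ (1 - 2 * M * (j * Real.exp (-(κ / 2) * j))) * (j * Real.log 2 / (ρ * j + 1)) * N :=
        mul_le_mul_of_nonneg_right hlim.le hN0'.le
    _ = N * (1 - 2 * M * (j * Real.exp (-(κ / 2) * j))) * (j * Real.log 2 / (ρ * j + 1)) := by
        ring
    _ ≤ wordCount N p.2 p.1 * (ρ * j + 1) * (j * Real.log 2 / (ρ * j + 1)) :=
        mul_le_mul_of_nonneg_right h3 (by positivity)
    _ = wordCount N p.2 p.1 * (j * Real.log 2) := by field_simp
    _ ≤ wordCount N p.2 p.1 * Real.log N :=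
        mul_le_mul_of_nonneg_left (mul_log_two_le_log hN1) (Nat.cast_nonneg _)

end Estimates

end ZivMerhav

/-! ### Conclusion. -/

open ZivMerhav
theorem corollary2p2 {A : Type*} [Fintype A] [MeasurableSpace A] [MeasurableSingletonClass A]
    (P Q : Measure (ℕ → A)) [IsProbabilityMeasure P] [IsProbabilityMeasure Q]
    (hP : MeasurePreserving shift P P) (hQ : MeasurePreserving shift Q Q)
    (hP_sld : SelectivelyLowerDecoupled P) (hP_ud : UpperDecoupled P)
    (hP_se : DecaysSlowlyEnough P) (hQ_ud : UpperDecoupled Q)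
    (h_nd : Nondegenerate P Q) (h_supp : seqSupp Q ⊆ seqSupp P)
    (q : ℝ → ℝ)
    (hq : ∃ u v : ℝ, u < 0 ∧ 0 < v ∧
      ∀ α ∈ Set.Ioo u v, Tendsto (pressureSeq P Q α) atTop (𝓝 ((q α : ℝ) : EReal)))
    (hq_diff : DifferentiableAt ℝ q 0) :
    ∃ h : ℝ, IsCrossEntropy P Q (h : EReal) ∧
      ∀ᵐ p ∂(P.prod Q), Tendsto (fun N : ℕ => mZMEstimator N p.2 p.1) atTop (𝓝 h) := by
  obtain ⟨u, v, hu, hv, hq⟩ := hq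
  have hb := momentBounds_of_hasDerivAt h_nd h_supp hu hv hq hq_diff.hasDerivAt
  refine ⟨deriv q 0, ?_, ?_⟩
  · refine ((continuous_coe_real_ereal.tendsto _).comp (hb.tendsto_meanInfo h_supp)).congr ?_
    exact fun n => (crossEntropySeq_eq h_supp n).symm
  · have hpos := hb.pos h_supp
    set h := deriv q 0
    -- A countable sequence of tolerances, all below `h` as the lower estimate requires.
    have hεpos : ∀ m : ℕ, 0 < h / (m + 2) := fun m => by positivity
    have hεlt : ∀ m : ℕ, h / (m + 2) < h := fun m =>
      div_lt_self hpos (by linarith [(Nat.cast_nonneg m : (0 : ℝ) ≤ m)])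
    have hup := ae_all_iff.mpr fun m : ℕ =>
      hb.ae_eventually_le h_supp hP hQ hP_sld (hεpos m)
    have hlo := ae_all_iff.mpr fun m : ℕ => hb.ae_eventually_ge hP hQ (hεpos m) (hεlt m)
    filter_upwards [hup, hlo] with p hup hlo
    refine tendsto_mZMEstimator (Metric.tendsto_nhds.mpr fun ε hε => ?_)
    obtain ⟨m, hm⟩ := exists_nat_gt (h / ε)
    have hmε : h / (m + 2) < ε := by
      rw [div_lt_iff₀ (by positivity)]
      rw [div_lt_iff₀ hε] at hm
      linarith
    filter_upwards [hup m, hlo m] with N h1 h2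
    rw [Real.dist_eq, abs_lt]
    constructor <;> linarith
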